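/- Let $M$ be a (finite-dimensional, Hausdorff, paracompact) smooth manifold and let $\omega$ be a 2-plectic form on $M$, i.e. a closed 3-form such that $\iota_v\omega=0$ implies $v=0$ for every tangent vector $v$. Let $(C,\langle\cdot,\cdot\rangle,[\![\cdot,\cdot]\!],\rho)$ be an exact Courant algebroid over $M$ (with skew-symmetric bracket $[\![\cdot,\cdot]\!]$ on $\Gamma(C)$, anchor $\rho\colon C\to TM$, and $D\colon C^\infty(M)\to\Gamma(C)$ given by $\langle Df,e\rangle=\rho(e)f$), and let $s\colon TM\to C$ be a splitting ($\rho\circ s=\mathrm{id}$, $\langle s(v_1),s(v_2)\rangle=0$) with curvature $-\omega$, i.e. $\langle[\![s(v_1),s(v_2)]\!],s(v_3)\rangle=-\omega(v_1,v_2,v_3)$ for all vector fields $v_1,v_2,v_3$. (Up to isomorphism, this pair $(C,s)$ is the exact Courant algebroid associated with $(M,\omega)$.) Here a Courant algebroid is a finite-rank smooth vector bundle $C\to M$ with a nondegenerate symmetric bilinear form $\langle\cdot,\cdot\rangle$ on its fibres, a skew-symmetric $\mathbb R$-bilinear bracket $[\![\cdot,\cdot]\!]$ on $\Gamma(C)$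 and a bundle map $\rho\colon C\to TM$ such that for all sections $e_i$ and smooth functions $f,g$: (1) $[\![e_1,[\![e_2,e_3]\!]]\!]-[\![[\![e_1,e_2]\!],e_3]\!]-[\![e_2,[\![e_1,e_3]\!]]\!]=-DT(e_1,e_2,e_3)$, where $T(e_1,e_2,e_3)=\tfrac16\bigl(\langle[\![e_1,e_2]\!],e_3\rangle+\langle[\![e_3,e_1]\!],e_2\rangle+\langle[\![e_2,e_3]\!],e_1\rangle\bigr)$; (2) $\rho([\![e_1,e_2]\!])=[\rho(e_1),\rho(e_2)]$; (3) $[\![e_1,fe_2]\!]=f[\![e_1,e_2]\!]+\rho(e_1)(f)e_2-\tfrac12\langle e_1,e_2\rangle Df$; (4) $\langle Df,Dg\rangle=0$; (5) $\rho(e_1)\langle e_2,e_3\rangle=\langle[\![e_1,e_2]\!]+\tfrac12D\langle e_1,e_2\rangle,e_3\rangle+\langle e_2,[\![e_1,e_3]\!]+\tfrac12D\langle e_1,e_3\rangle\rangle$. It is exact if $0\to T^*M\xrightarrow{\rho^*}C\xrightarrow{\rho}TM\to0$ is exact, where $C\cong C^*$ by the bilinear form. A Lie 2-algebra is a 2-term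 complex of real vector spaces $L_1\xrightarrow{d}L_0$ with a skew-symmetric chain map $[\cdot,\cdot]\colon L\otimes L\to L$ and a skew-symmetric chain homotopy $J\colon L^{\otimes 3}\to L$ (the Jacobiator) from $[x,[y,z]]$ to $[[x,y],z]+[y,[x,z]]$ such that $$[x,J(y,z,w)]+J(x,[y,z],w)+J(x,z,[y,w])+[J(x,y,z),w]+[z,J(x,y,w)]$$ $$=J(x,y,[z,w])+J([x,y],z,w)+[y,J(x,z,w)]+J(y,[x,z],w)+J(y,z,[x,w]).$$ Here a chain homotopy $H$ from $G$ to $G'$ satisfies $G-G'=dH+Hd$. A morphism $L\to L'$ is a chain map $\phi=(\phi_0,\phi_1)$ with a skew-symmetric chain homotopy $\Phi\colon L\otimes L\to L'$ from $\phi([x,y])$ to $[\phi(x),\phi(y)]'$ such that $$\phi_1(J(x,y,z))-J'(\phi_0(x),\phi_0(y),\phi_0(z))=\Phi(x,[y,z])-\Phi([x,y],z)-\Phi(y,[x,z])$$ $$-[\Phi(x,y),\phi_0(z)]'+[\phi_0(x),\Phi(y,z)]'-[\phi_0(y),\Phi(x,z)]'.$$ An isomorphism is a morphism with a two-sided inverse,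 the composite of $(\phi,\Phi)$ followed by $(\psi,\Psi)$ being $\bigl(\psi\phi,\ \Psi(\phi_0x,\phi_0y)+\psi_1\Phi(x,y)\bigr)$ and the identity being $(\mathrm{id},0)$. A 1-form $\alpha$ is Hamiltonian if there is a vector field $v_\alpha$ (then unique) with $d\alpha=-\iota_{v_\alpha}\omega$. Let $L_\infty(M,\omega)$ be the complex $C^\infty(M)\xrightarrow{d}\Omega^1_{\mathrm{Ham}}(M)$ with bracket $\{\alpha,\beta\}=\omega(v_\alpha,v_\beta,\cdot)$ in degree $0$ and zero otherwise, and Jacobiator $J(\alpha,\beta,\gamma)=\omega(v_\gamma,v_\beta,v_\alpha)$. A section $e\in\Gamma(C)$ preserves the splitting if $[\![e,s(v')]\!]+\tfrac12D\langle e,s(v')\rangle=s([\rho(e),v'])$ for every vector field $v'$ (the left-hand side is the Dorfman bracket); let $\Gamma(C)^s$ be the space of these sections. Let $L_\infty(C)^s$ be the complex $C^\infty(M)\xrightarrow{D}\Gamma(C)^s$ with bracket $[e_1,e_2]=[\![e_1,e_2]\!]$ in degree $0$, $[e,f]=-[f,e]=\tfrac12\langle e,Df\rangle$ in degree $1$,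 and Jacobiator $J=-T$. Then $L_\infty(M,\omega)$ and $L_\infty(C)^s$ are well-defined Lie 2-algebras, and they are isomorphic as Lie 2-algebras. -/

import Mathlib

set_option maxSynthPendingDepth 3
set_option linter.unusedSectionVars false

open Bundle VectorField
open scoped Manifold ContDiff

noncomputable section

namespace TwoPlectic

/-! ## Lie 2-algebras -/

section LieTwoAlgebras

/-- A (semistrict, real) Lie 2-algebra on a 2-term complex `d : L₁ → L₀`.

The skew-symmetric chain map `[·,·] : L ⊗ L → L` has the components `bracket` on `L₀ ⊗ L₀` and
`act x f = [x, f]` on `L₀ ⊗ L₁`; by graded skew-symmetry `[f, x] = -[x, f]`, and `[f, g] = 0` for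
degree reasons. The Jacobiator `jac` is a skew-symmetric chain homotopy from `[x, [y, z]]` to
`[[x, y], z] + [y, [x, z]]`. A chain homotopy `H` from `G` to `G'` satisfies `G - G' = d H + H d`. -/
structure LieTwoAlgebra (L₀ L₁ : Type*) [AddCommGroup L₀] [Module ℝ L₀]
    [AddCommGroup L₁] [Module ℝ L₁] where
  d : L₁ →ₗ[ℝ] L₀
  bracket : L₀ →ₗ[ℝ] L₀ →ₗ[ℝ] L₀
  act : L₀ →ₗ[ℝ] L₁ →ₗ[ℝ] L₁
  jac : L₀ →ₗ[ℝ] L₀ →ₗ[ℝ] L₀ →ₗ[ℝ] L₁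
  bracket_skew : ∀ x y, bracket x y = -bracket y x
  /-- The bracket is a chain map, degree one: `d [x, f] = [x, d f]`. -/
  d_act : ∀ x f, d (act x f) = bracket x (d f)
  /-- The bracket is a chain map, degree two: `[d f, g] = [f, d g] = -[d g, f]`. -/
  act_d : ∀ f g, act (d f) g = -act (d g) f
  jac_skew_left : ∀ x y z, jac x y z = -jac y x z
  jac_skew_right : ∀ x y z, jac x y z = -jac x z y
  /-- The homotopy condition on `L₀ ⊗ L₀ ⊗ L₀`. -/
  jacobi : ∀ x y z,
    bracket x (bracket y z) - (bracket (bracket x y) z + bracket y (bracket x z)) = d (jac x y z)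
  /-- The homotopy condition on `L₀ ⊗ L₀ ⊗ L₁`; by skew-symmetry this is also the condition on
  `L₀ ⊗ L₁ ⊗ L₀` and on `L₁ ⊗ L₀ ⊗ L₀`. -/
  jacobi_act : ∀ x y f,
    act x (act y f) - (act (bracket x y) f + act y (act x f)) = jac x y (d f)
  /-- The coherence law; `[J(x,y,z), w]` is written `-act w (jac x y z)`. -/
  coherence : ∀ x y z w,
    act x (jac y z w) + jac x (bracket y z) w + jac x z (bracket y w) + -act w (jac x y z)
        + act z (jac x y w)
      = jac x y (bracket z w) + jac (bracket x y) z w + act y (jac x z w)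
        + jac y (bracket x z) w + jac y z (bracket x w)

variable {L₀ L₁ L₀' L₁' : Type*}
  [AddCommGroup L₀] [Module ℝ L₀] [AddCommGroup L₁] [Module ℝ L₁]
  [AddCommGroup L₀'] [Module ℝ L₀'] [AddCommGroup L₁'] [Module ℝ L₁']

/-- A morphism of Lie 2-algebras: a chain map `φ = (φ₀, φ₁)` and a skew-symmetric chain homotopy
`Φ` from `φ [x, y]` to `[φ x, φ y]'`, satisfying a coherence law. -/
structure LieTwoAlgebra.Hom (A : LieTwoAlgebra L₀ L₁) (B : LieTwoAlgebra L₀' L₁') where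
  φ₀ : L₀ →ₗ[ℝ] L₀'
  φ₁ : L₁ →ₗ[ℝ] L₁'
  Φ : L₀ →ₗ[ℝ] L₀ →ₗ[ℝ] L₁'
  comm_d : ∀ f, φ₀ (A.d f) = B.d (φ₁ f)
  Φ_skew : ∀ x y, Φ x y = -Φ y x
  /-- The homotopy condition on `L₀ ⊗ L₀`. -/
  map_bracket : ∀ x y, φ₀ (A.bracket x y) - B.bracket (φ₀ x) (φ₀ y) = B.d (Φ x y)
  /-- The homotopy condition on `L₀ ⊗ L₁`; by skew-symmetry also the one on `L₁ ⊗ L₀`. -/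
  map_act : ∀ x f, φ₁ (A.act x f) - B.act (φ₀ x) (φ₁ f) = Φ x (A.d f)
  /-- The coherence law; `[Φ(x,y), φ₀ z]'` is written `-B.act (φ₀ z) (Φ x y)`. -/
  coherence : ∀ x y z,
    φ₁ (A.jac x y z) - B.jac (φ₀ x) (φ₀ y) (φ₀ z)
      = Φ x (A.bracket y z) - Φ (A.bracket x y) z - Φ y (A.bracket x z)
        - -B.act (φ₀ z) (Φ x y) + B.act (φ₀ x) (Φ y z) - B.act (φ₀ y) (Φ x z)

/-- The composite of `F = (φ, Φ)` followed by `G = (ψ, Ψ)` is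
`(ψ ∘ φ, (x, y) ↦ Ψ(φ₀ x, φ₀ y) + ψ₁ (Φ(x, y)))`. This says that it is the identity `(id, 0)`. -/
def LieTwoAlgebra.Hom.CompEqId {A : LieTwoAlgebra L₀ L₁} {B : LieTwoAlgebra L₀' L₁'}
    (F : A.Hom B) (G : B.Hom A) : Prop :=
  (∀ x, G.φ₀ (F.φ₀ x) = x) ∧ (∀ f, G.φ₁ (F.φ₁ f) = f) ∧
    ∀ x y, G.Φ (F.φ₀ x) (F.φ₀ y) + G.φ₁ (F.Φ x y) = 0

/-- Two Lie 2-algebras are isomorphic if there are mutually inverse morphisms between them. -/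
def LieTwoAlgebra.Isomorphic (A : LieTwoAlgebra L₀ L₁) (B : LieTwoAlgebra L₀' L₁') : Prop :=
  ∃ (F : A.Hom B) (G : B.Hom A), F.CompEqId G ∧ G.CompEqId F

end LieTwoAlgebras

/-! ## Vector fields, differential forms and 2-plectic forms

`M` is a smooth manifold modelled on the finite-dimensional real vector space `E`. -/

section Manifolds

variable (E : Type*) [NormedAddCommGroup E] [NormedSpace ℝ E]
  (M : Type*) [TopologicalSpace M] [ChartedSpace E M]

/-- Smooth real functions on `M`. -/
abbrev SmoothFn := C^∞⟮𝓘(ℝ, E), M; 𝓘(ℝ, ℝ), ℝ⟯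

variable [IsManifold 𝓘(ℝ, E) ∞ M]

/-- Smooth vector fields on `M`. -/
abbrev VF := Cₛ^∞⟮𝓘(ℝ, E); E, fun x : M => TangentSpace 𝓘(ℝ, E) x⟯

/-- Differential 1-forms on `M`: smooth sections of the cotangent bundle. -/
abbrev OneForm := Cₛ^∞⟮𝓘(ℝ, E); E →L[ℝ] ℝ,
  fun x : M => TangentSpace 𝓘(ℝ, E) x →L[ℝ] Trivial M ℝ x⟯

/-- Differential 3-forms on `M`: smooth sections of the bundle of trilinear forms on the tangent
spaces which are alternating. -/
structure ThreeForm where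
  toSection : Cₛ^∞⟮𝓘(ℝ, E); E →L[ℝ] E →L[ℝ] E →L[ℝ] ℝ,
    fun x : M => TangentSpace 𝓘(ℝ, E) x →L[ℝ] TangentSpace 𝓘(ℝ, E) x →L[ℝ]
      TangentSpace 𝓘(ℝ, E) x →L[ℝ] Trivial M ℝ x⟯
  alternating_left : ∀ (x : M) (u w : TangentSpace 𝓘(ℝ, E) x), toSection x u u w = 0
  alternating_right : ∀ (x : M) (u w : TangentSpace 𝓘(ℝ, E) x), toSection x u w w = 0

variable {E M}

/-- The value of a 3-form on three tangent vectors at `x`. -/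
def ThreeForm.val (Ω : ThreeForm E M) (x : M) (u v w : TangentSpace 𝓘(ℝ, E) x) : ℝ :=
  Ω.toSection x u v w

/-- The function `ω(u, v, w)` for vector fields `u, v, w`. -/
def ThreeForm.eval (Ω : ThreeForm E M) (u v w : Π x : M, TangentSpace 𝓘(ℝ, E) x) (x : M) : ℝ :=
  Ω.val x (u x) (v x) (w x)

/-- The function `α(u)` for a vector field `u`. -/
def evalOne (α : OneForm E M) (u : Π x : M, TangentSpace 𝓘(ℝ, E) x) (x : M) : ℝ := α x (u x)

/-- The derivative `u(f)` of the function `f` along the vector field `u`. -/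
def dirDeriv (u : Π x : M, TangentSpace 𝓘(ℝ, E) x) (f : M → ℝ) (x : M) : ℝ :=
  mfderiv 𝓘(ℝ, E) 𝓘(ℝ, ℝ) f x (u x)

/-- The exterior derivative of a 1-form, evaluated on two vector fields:
`dα(u, w) = u(α(w)) - w(α(u)) - α([u, w])`. -/
def extDerivOne (α : OneForm E M) (u w : VF E M) (x : M) : ℝ :=
  dirDeriv u (evalOne α w) x - dirDeriv w (evalOne α u) x - evalOne α (mlieBracket 𝓘(ℝ, E) u w) x

/-- The exterior derivative of a 3-form, evaluated on four vector fields: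
`dω(u₀, …, u₃) = ∑ᵢ (-1)ⁱ uᵢ(ω(…, ûᵢ, …)) + ∑_{i<j} (-1)^{i+j} ω([uᵢ, uⱼ], …, ûᵢ, …, ûⱼ, …)`. -/
def ThreeForm.extDeriv (Ω : ThreeForm E M) (u₀ u₁ u₂ u₃ : VF E M) (x : M) : ℝ :=
  dirDeriv u₀ (Ω.eval u₁ u₂ u₃) x - dirDeriv u₁ (Ω.eval u₀ u₂ u₃) x
    + dirDeriv u₂ (Ω.eval u₀ u₁ u₃) x - dirDeriv u₃ (Ω.eval u₀ u₁ u₂) x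
    - Ω.eval (mlieBracket 𝓘(ℝ, E) u₀ u₁) u₂ u₃ x + Ω.eval (mlieBracket 𝓘(ℝ, E) u₀ u₂) u₁ u₃ x
    - Ω.eval (mlieBracket 𝓘(ℝ, E) u₀ u₃) u₁ u₂ x - Ω.eval (mlieBracket 𝓘(ℝ, E) u₁ u₂) u₀ u₃ x
    + Ω.eval (mlieBracket 𝓘(ℝ, E) u₁ u₃) u₀ u₂ x - Ω.eval (mlieBracket 𝓘(ℝ, E) u₂ u₃) u₀ u₁ x

/-- A 2-plectic form is a closed 3-form which is nondegenerate: `ι_v Ω = 0` only for `v = 0`. -/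
structure ThreeForm.IsTwoPlectic (Ω : ThreeForm E M) : Prop where
  closed : ∀ (u₀ u₁ u₂ u₃ : VF E M) (x : M), Ω.extDeriv u₀ u₁ u₂ u₃ x = 0
  nondegenerate : ∀ (x : M) (v : TangentSpace 𝓘(ℝ, E) x), (∀ u w, Ω.val x v u w = 0) → v = 0

/-- `v` is a Hamiltonian vector field of the 1-form `α`: `dα = -ι_v ω`. -/
def ThreeForm.IsHamiltonianVF (Ω : ThreeForm E M) (α : OneForm E M) (v : VF E M) : Prop :=
  ∀ (u w : VF E M) (x : M), extDerivOne α u w x = -Ω.eval v u w x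

theorem mdifferentiableAt_evalOne (α : OneForm E M) (u : VF E M) (x : M) :
    MDifferentiableAt 𝓘(ℝ, E) 𝓘(ℝ, ℝ) (evalOne α u) x := by
  have h' : ContMDiff 𝓘(ℝ, E) 𝓘(ℝ, ℝ) ∞ (evalOne α u) := by
    intro y
    have := (α.contMDiff).clm_bundle_apply (v := fun m => u m) u.contMDiff y
    simp only [contMDiffAt_section] at this
    exact this
  exact h'.mdifferentiable (by simp) x

theorem dirDeriv_add (u : VF E M) {f g : M → ℝ} {x : M}
    (hf : MDifferentiableAt 𝓘(ℝ, E) 𝓘(ℝ, ℝ) f x) (hg : MDifferentiableAt 𝓘(ℝ, E) 𝓘(ℝ, ℝ) g x) :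
    dirDeriv u (f + g) x = dirDeriv u f x + dirDeriv u g x := by
  rw [dirDeriv, mfderiv_add hf hg]; rfl

theorem dirDeriv_smul (u : VF E M) {f : M → ℝ} {x : M} (c : ℝ)
    (hf : MDifferentiableAt 𝓘(ℝ, E) 𝓘(ℝ, ℝ) f x) :
    dirDeriv u (c • f) x = c * dirDeriv u f x := by
  rw [dirDeriv, const_smul_mfderiv hf]; rfl

theorem extDerivOne_add (α β : OneForm E M) (u w : VF E M) (x : M) :
    extDerivOne (α + β) u w x = extDerivOne α u w x + extDerivOne β u w x := by
  have h (v : Π x : M, TangentSpace 𝓘(ℝ, E) x) :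
      evalOne (α + β) v = evalOne α v + evalOne β v := rfl
  simp only [extDerivOne, h, dirDeriv_add _ (mdifferentiableAt_evalOne _ _ _)
    (mdifferentiableAt_evalOne _ _ _), Pi.add_apply]
  ring

theorem extDerivOne_smul (c : ℝ) (α : OneForm E M) (u w : VF E M) (x : M) :
    extDerivOne (c • α) u w x = c * extDerivOne α u w x := by
  have h (v : Π x : M, TangentSpace 𝓘(ℝ, E) x) : evalOne (c • α) v = c • evalOne α v := rfl
  simp only [extDerivOne, h, dirDeriv_smul _ _ (mdifferentiableAt_evalOne _ _ _), Pi.smul_apply,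
    smul_eq_mul]
  ring

/-- The space of Hamiltonian 1-forms. -/
def ThreeForm.hamiltonianForms (Ω : ThreeForm E M) : Submodule ℝ (OneForm E M) where
  carrier := {α | ∃ v : VF E M, Ω.IsHamiltonianVF α v}
  zero_mem' := ⟨0, fun u w x => by
    have h := extDerivOne_smul (0 : ℝ) (0 : OneForm E M) u w x
    rw [zero_smul, zero_mul] at h
    simp [h, ThreeForm.eval, ThreeForm.val]⟩
  add_mem' := by
    rintro α β ⟨v, hv⟩ ⟨v', hv'⟩
    refine ⟨v + v', fun u w x => ?_⟩
    rw [extDerivOne_add, hv, hv']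
    simp only [ThreeForm.eval, ThreeForm.val, ContMDiffSection.coe_add, Pi.add_apply, map_add,
      _root_.add_apply]
    exact (neg_add _ _).symm
  smul_mem' := by
    rintro c α ⟨v, hv⟩
    refine ⟨c • v, fun u w x => ?_⟩
    rw [extDerivOne_smul, hv]
    simp only [ThreeForm.eval, ThreeForm.val, ContMDiffSection.coe_smul, Pi.smul_apply, map_smul,
      _root_.smul_apply]
    exact mul_neg _ _

/-- `A` is the Lie 2-algebra `L_∞(M, ω)` on the complex `d : C^∞(M) → Ω¹_Ham(M)`: the differential
is the de Rham differential, the bracket is `{α, β} = ω(v_α, v_β, ·)` in degree zero and trivial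
otherwise, and the Jacobiator is `J(α, β, γ) = ω(v_γ, v_β, v_α)`, where `v_α`, `v_β`, `v_γ` are
the Hamiltonian vector fields. These equations determine `A`. -/
structure ThreeForm.IsHamiltonianLieTwoAlgebra (Ω : ThreeForm E M)
    (A : LieTwoAlgebra Ω.hamiltonianForms (SmoothFn E M)) : Prop where
  d_eq : ∀ (f : SmoothFn E M) (x : M) (w : TangentSpace 𝓘(ℝ, E) x),
    (A.d f : OneForm E M) x w = mfderiv 𝓘(ℝ, E) 𝓘(ℝ, ℝ) f x w
  bracket_eq : ∀ (α β : Ω.hamiltonianForms) (u v : VF E M),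
    Ω.IsHamiltonianVF α u → Ω.IsHamiltonianVF β v →
      ∀ (x : M) (w : TangentSpace 𝓘(ℝ, E) x),
        (A.bracket α β : OneForm E M) x w = Ω.val x (u x) (v x) w
  act_eq : ∀ (α : Ω.hamiltonianForms) (f : SmoothFn E M), A.act α f = 0
  jac_eq : ∀ (α β γ : Ω.hamiltonianForms) (u v w : VF E M),
    Ω.IsHamiltonianVF α u → Ω.IsHamiltonianVF β v → Ω.IsHamiltonianVF γ w →
      ∀ x : M, A.jac α β γ x = Ω.val x (w x) (v x) (u x)

end Manifolds

/-! ## Courant algebroids -/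

section Courant

variable (E : Type*) [NormedAddCommGroup E] [NormedSpace ℝ E]
  (M : Type*) [TopologicalSpace M] [ChartedSpace E M] [IsManifold 𝓘(ℝ, E) ∞ M]
  (F : Type*) [NormedAddCommGroup F] [NormedSpace ℝ F]
  (C : M → Type*) [TopologicalSpace (TotalSpace F C)] [∀ x, TopologicalSpace (C x)]
  [∀ x, AddCommGroup (C x)] [∀ x, Module ℝ (C x)]
  [∀ x, IsTopologicalAddGroup (C x)] [∀ x, ContinuousSMul ℝ (C x)]
  [FiberBundle F C] [VectorBundle ℝ F C] [ContMDiffVectorBundle ∞ F C 𝓘(ℝ, E)]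

/-- Smooth sections of the vector bundle `C → M`. -/
abbrev Sec := Cₛ^∞⟮𝓘(ℝ, E); F, C⟯

/-- The data of a Courant algebroid structure on the vector bundle `C → M`: a bilinear form on the
bundle, a bundle map `anchor` to the tangent bundle, an `ℝ`-bilinear bracket on sections, and the
operator `D`. -/
structure CourantData where
  pairing : Cₛ^∞⟮𝓘(ℝ, E); F →L[ℝ] F →L[ℝ] ℝ,
    fun x : M => C x →L[ℝ] C x →L[ℝ] Trivial M ℝ x⟯
  anchor : Cₛ^∞⟮𝓘(ℝ, E); F →L[ℝ] E, fun x : M => C x →L[ℝ] TangentSpace 𝓘(ℝ, E) x⟯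
  bracket : Sec E M F C →ₗ[ℝ] Sec E M F C →ₗ[ℝ] Sec E M F C
  D : SmoothFn E M →ₗ[ℝ] Sec E M F C

variable {E M F C}

/-- The product of a section with a function. -/
def fsmul (f : SmoothFn E M) (e : Sec E M F C) : Sec E M F C :=
  ⟨fun x => f x • e x, f.contMDiff.smul_section e.contMDiff⟩

namespace CourantData

variable (K : CourantData E M F C)

/-- The symmetric bilinear form on a fibre. -/
def form (x : M) (a b : C x) : ℝ := K.pairing x a b

/-- The function `⟨e₁, e₂⟩`. -/
def pair (e₁ e₂ : Sec E M F C) : SmoothFn E M :=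
  ⟨fun x => K.form x (e₁ x) (e₂ x), fun y => by
    have := ((K.pairing.contMDiff).clm_bundle_apply (v := fun m => e₁ m)
      e₁.contMDiff).clm_bundle_apply (v := fun m => e₂ m) e₂.contMDiff y
    simp only [contMDiffAt_section] at this
    exact this⟩

/-- The vector field `ρ(e)`. -/
def rho (e : Sec E M F C) : VF E M :=
  ⟨fun x => K.anchor x (e x), (K.anchor.contMDiff).clm_bundle_apply e.contMDiff⟩

/-- `T(e₁, e₂, e₃) = (1/6) (⟨⟦e₁, e₂⟧, e₃⟩ + ⟨⟦e₃, e₁⟧, e₂⟩ + ⟨⟦e₂, e₃⟧, e₁⟩)`. -/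
def T (e₁ e₂ e₃ : Sec E M F C) : SmoothFn E M :=
  (1 / 6 : ℝ) • (K.pair (K.bracket e₁ e₂) e₃ + K.pair (K.bracket e₃ e₁) e₂
    + K.pair (K.bracket e₂ e₃) e₁)

/-- The axioms of a Courant algebroid (with skew-symmetric bracket). -/
structure IsCourantAlgebroid : Prop where
  symm : ∀ (x : M) (a b : C x), K.form x a b = K.form x b a
  nondegenerate : ∀ (x : M) (a : C x), (∀ b, K.form x a b = 0) → a = 0
  /-- This determines the section `D f`, by nondegeneracy. -/
  form_D : ∀ (f : SmoothFn E M) (x : M) (a : C x),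
    K.form x (K.D f x) a = mfderiv 𝓘(ℝ, E) 𝓘(ℝ, ℝ) f x (K.anchor x a)
  bracket_skew : ∀ e₁ e₂, K.bracket e₁ e₂ = -K.bracket e₂ e₁
  jacobi : ∀ e₁ e₂ e₃,
    K.bracket e₁ (K.bracket e₂ e₃) - K.bracket (K.bracket e₁ e₂) e₃
      - K.bracket e₂ (K.bracket e₁ e₃) = -K.D (K.T e₁ e₂ e₃)
  rho_bracket : ∀ (e₁ e₂ : Sec E M F C) (x : M),
    K.rho (K.bracket e₁ e₂) x = mlieBracket 𝓘(ℝ, E) (K.rho e₁) (K.rho e₂) x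
  leibniz : ∀ (e₁ e₂ : Sec E M F C) (f : SmoothFn E M) (x : M),
    K.bracket e₁ (fsmul f e₂) x = f x • K.bracket e₁ e₂ x + dirDeriv (K.rho e₁) f x • e₂ x
      - ((1 / 2 : ℝ) * K.pair e₁ e₂ x) • K.D f x
  pair_D_D : ∀ f g, K.pair (K.D f) (K.D g) = 0
  invariance : ∀ (e₁ e₂ e₃ : Sec E M F C) (x : M),
    dirDeriv (K.rho e₁) (K.pair e₂ e₃) x
      = K.pair (K.bracket e₁ e₂ + (1 / 2 : ℝ) • K.D (K.pair e₁ e₂)) e₃ x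
        + K.pair e₂ (K.bracket e₁ e₃ + (1 / 2 : ℝ) • K.D (K.pair e₁ e₃)) x

/-- `c = ρ^*(ξ)`, where `ρ^* : T^*M → C` is the dual of the anchor, `C` being identified with its
dual bundle by the bilinear form. -/
def IsCoanchor (x : M) (ξ : TangentSpace 𝓘(ℝ, E) x →L[ℝ] ℝ) (c : C x) : Prop :=
  ∀ a : C x, K.form x c a = ξ (K.anchor x a)

/-- Exactness of `0 → T^*M → C → TM → 0`, the maps being `ρ^*` and `ρ`. -/
structure IsExact : Prop where
  coanchor_injective : ∀ (x : M) (ξ : TangentSpace 𝓘(ℝ, E) x →L[ℝ] ℝ),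
    K.IsCoanchor x ξ 0 → ξ = 0
  exact : ∀ (x : M) (c : C x), K.anchor x c = 0 ↔ ∃ ξ, K.IsCoanchor x ξ c
  anchor_surjective : ∀ x : M, Function.Surjective (K.anchor x)

variable (E M F C) in
/-- Smooth bundle maps `TM → C`. -/
abbrev BundleMap :=
  Cₛ^∞⟮𝓘(ℝ, E); E →L[ℝ] F, fun x : M => TangentSpace 𝓘(ℝ, E) x →L[ℝ] C x⟯

/-- The section `s(v)`. -/
def lift (s : BundleMap E M F C) (v : VF E M) : Sec E M F C :=
  ⟨fun x => s x (v x), (s.contMDiff).clm_bundle_apply v.contMDiff⟩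

/-- An (isotropic) splitting of an exact Courant algebroid. -/
structure IsSplitting (s : BundleMap E M F C) : Prop where
  anchor_comp : ∀ (x : M) (v : TangentSpace 𝓘(ℝ, E) x), K.anchor x (s x v) = v
  isotropic : ∀ (x : M) (u v : TangentSpace 𝓘(ℝ, E) x), K.form x (s x u) (s x v) = 0

/-- The splitting `s` has curvature `-ω`: `⟨⟦s(v₁), s(v₂)⟧, s(v₃)⟩ = -ω(v₁, v₂, v₃)`. -/
def HasCurvatureNeg (s : BundleMap E M F C) (Ω : ThreeForm E M) : Prop :=
  ∀ (v₁ v₂ v₃ : VF E M) (x : M),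
    K.pair (K.bracket (lift s v₁) (lift s v₂)) (lift s v₃) x = -Ω.eval v₁ v₂ v₃ x

/-- The Dorfman bracket `⟦e₁, e₂⟧ + (1/2) D⟨e₁, e₂⟩`. -/
def dorfman (e₁ e₂ : Sec E M F C) : Sec E M F C :=
  K.bracket e₁ e₂ + (1 / 2 : ℝ) • K.D (K.pair e₁ e₂)

theorem rho_add (e₁ e₂ : Sec E M F C) :
    (K.rho (e₁ + e₂) : Π x : M, TangentSpace 𝓘(ℝ, E) x) = K.rho e₁ + K.rho e₂ :=
  funext fun x => map_add (K.anchor x) (e₁ x) (e₂ x)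

theorem rho_smul (c : ℝ) (e : Sec E M F C) :
    (K.rho (c • e) : Π x : M, TangentSpace 𝓘(ℝ, E) x) = c • K.rho e :=
  funext fun x => map_smul (K.anchor x) c (e x)

theorem dorfman_add (e₁ e₂ e : Sec E M F C) :
    K.dorfman (e₁ + e₂) e = K.dorfman e₁ e + K.dorfman e₂ e := by
  have h : K.pair (e₁ + e₂) e = K.pair e₁ e + K.pair e₂ e := by
    ext x
    exact congrArg (fun φ => φ (e x)) (map_add (K.pairing x) (e₁ x) (e₂ x))
  simp only [dorfman, h, map_add, LinearMap.add_apply, smul_add]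
  abel

theorem dorfman_smul (c : ℝ) (e₁ e : Sec E M F C) :
    K.dorfman (c • e₁) e = c • K.dorfman e₁ e := by
  have h : K.pair (c • e₁) e = c • K.pair e₁ e := by
    ext x
    exact congrArg (fun φ => φ (e x)) (map_smul (K.pairing x) c (e₁ x))
  simp only [dorfman, h, map_smul, LinearMap.smul_apply, smul_add, smul_comm c]

/-- The section `e = s(v) + α`, where `v = ρ(e)`, preserves the splitting `s`: the Dorfman bracket
of `e` and `s(v')` is `s([v, v'])` for every vector field `v'`. -/
def Preserves (s : BundleMap E M F C) (e : Sec E M F C) : Prop :=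
  ∀ (v' : VF E M) (x : M),
    K.dorfman e (lift s v') x = s x (mlieBracket 𝓘(ℝ, E) (K.rho e) v' x)

variable [FiniteDimensional ℝ E] in
/-- The space `Γ(C)^s` of sections which preserve the splitting `s`. -/
def preserving (s : BundleMap E M F C) : Submodule ℝ (Sec E M F C) where
  carrier := {e | K.Preserves s e}
  zero_mem' := by
    intro v' x
    have h : K.dorfman (0 : Sec E M F C) (lift s v') = 0 := by
      simpa using K.dorfman_smul 0 0 (lift s v')
    have h' : (K.rho (0 : Sec E M F C) : Π x : M, TangentSpace 𝓘(ℝ, E) x) = 0 := by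
      simpa using K.rho_smul 0 0
    rw [h, h', mlieBracket_zero_left]
    simp
  add_mem' := by
    intro e₁ e₂ h₁ h₂ v' x
    have := FiniteDimensional.complete ℝ E
    rw [dorfman_add, rho_add, mlieBracket_add_left (K.rho e₁).mdifferentiableAt
      (K.rho e₂).mdifferentiableAt, map_add, ← h₁, ← h₂]
    rfl
  smul_mem' := by
    intro c e h v' x
    have := FiniteDimensional.complete ℝ E
    rw [dorfman_smul, rho_smul, mlieBracket_const_smul_left (K.rho e).mdifferentiableAt,
      map_smul, ← h]
    rfl

variable [FiniteDimensional ℝ E] in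
/-- `B` is the Lie 2-algebra `L_∞(C)^s` on the complex `D : C^∞(M) → Γ(C)^s`, whose operations
are those of `L_∞(C)`: the bracket is the bracket of the Courant algebroid in degree zero and
`[e, f] = (1/2) ⟨e, D f⟩` in degree one, and the Jacobiator is `-T`. These equations determine
`B`. -/
structure IsPreservingLieTwoAlgebra (s : BundleMap E M F C)
    (B : LieTwoAlgebra (K.preserving s) (SmoothFn E M)) : Prop where
  d_eq : ∀ f : SmoothFn E M, (B.d f : Sec E M F C) = K.D f
  bracket_eq : ∀ e₁ e₂ : K.preserving s, (B.bracket e₁ e₂ : Sec E M F C) = K.bracket e₁ e₂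
  act_eq : ∀ (e : K.preserving s) (f : SmoothFn E M),
    B.act e f = (1 / 2 : ℝ) • K.pair e (K.D f)
  jac_eq : ∀ e₁ e₂ e₃ : K.preserving s, B.jac e₁ e₂ e₃ = -K.T e₁ e₂ e₃

end CourantData

end Courant

end TwoPlectic

end

/-! Exactness and the splitting identify a section `e` with the pair `(v, α)`, where `v = ρ(e)` and
`α = ⟨e, s(·)⟩`; in these terms `⟨e, e'⟩ = α(v') + α'(v)` (`sec_ext`, `pairL_eq`,
`exists_toForm_eq_and_rhoL_eq`). Invariance of the pairing and the curvature condition show that `⟨e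
∘ s(b), s(c)⟩ = -ω(v, b, c) - dα(b, c)`, with `∘` the Dorfman bracket. Hence `e` preserves the
splitting exactly when `dα = -ι_v ω`, that is, when `v` is a Hamiltonian vector field of `α`
(`preserves_iff`). Since `v` is then determined by `α`, the map `e ↦ α` is a bijection from `Γ(C)^s`
onto the Hamiltonian 1-forms (`toHamiltonianForm_bijective`).

This bijection, with the identity on functions, is not strict. The form of `⟦e₁, e₂⟧` is `ω(v₁, v₂,
·)` plus the exact form `d Φ(e₁, e₂)`, where `Φ(e₁, e₂) = ½ (α₂(v₁) - α₁(v₂))` (`toForm_bracket`).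
This `Φ` also accounts for the action `½ ⟨e, D f⟩`, which vanishes on the Hamiltonian side, and for
the difference of the Jacobiators (`neg_T_eq`). So it is the homotopy of a morphism, and a morphism
bijective in both degrees is invertible (`Hom.isomorphic`).

The axioms for `L_∞(M, ω)` come from Cartan calculus: Hamiltonian vector fields preserve `ω`, and
`[u, v]` is Hamiltonian for `ω(u, v, ·)`. Those for `L_∞(C)^s` are not checked in the Courant
algebroid: they are transported from `L_∞(M, ω)` along the injection `e ↦ α` and the homotopy `Φ`
(`LieTwoAlgebra.pullback`). -/

/-! ### Smoothness of composites and inverses of bundle maps. -/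

section BundleMaps

variable {𝕜 B F₁ F₂ F₃ : Type*} [NontriviallyNormedField 𝕜] {n : WithTop ℕ∞}
  {E₁ : B → Type*} [∀ x, AddCommGroup (E₁ x)] [∀ x, Module 𝕜 (E₁ x)]
  [NormedAddCommGroup F₁] [NormedSpace 𝕜 F₁]
  [TopologicalSpace (TotalSpace F₁ E₁)] [∀ x, TopologicalSpace (E₁ x)]
  {E₂ : B → Type*} [∀ x, AddCommGroup (E₂ x)] [∀ x, Module 𝕜 (E₂ x)]
  [NormedAddCommGroup F₂] [NormedSpace 𝕜 F₂]
  [TopologicalSpace (TotalSpace F₂ E₂)] [∀ x, TopologicalSpace (E₂ x)]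
  {E₃ : B → Type*} [∀ x, AddCommGroup (E₃ x)] [∀ x, Module 𝕜 (E₃ x)]
  [NormedAddCommGroup F₃] [NormedSpace 𝕜 F₃]
  [TopologicalSpace (TotalSpace F₃ E₃)] [∀ x, TopologicalSpace (E₃ x)]
  {EB : Type*} [NormedAddCommGroup EB] [NormedSpace 𝕜 EB] {HB : Type*} [TopologicalSpace HB]
  {IB : ModelWithCorners 𝕜 EB HB} [TopologicalSpace B] [ChartedSpace HB B]
  [FiberBundle F₁ E₁] [VectorBundle 𝕜 F₁ E₁]
  [FiberBundle F₂ E₂] [VectorBundle 𝕜 F₂ E₂]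
  [FiberBundle F₃ E₃] [VectorBundle 𝕜 F₃ E₃]
  [∀ x, IsTopologicalAddGroup (E₁ x)] [∀ x, ContinuousSMul 𝕜 (E₁ x)]
  [∀ x, IsTopologicalAddGroup (E₂ x)] [∀ x, ContinuousSMul 𝕜 (E₂ x)]
  [∀ x, IsTopologicalAddGroup (E₃ x)] [∀ x, ContinuousSMul 𝕜 (E₃ x)]

open ContinuousLinearMap in
/-- The composition of smooth bundle maps is smooth. -/
theorem ContMDiff.clm_bundle_comp
    {g : ∀ x, E₂ x →L[𝕜] E₃ x} {f : ∀ x, E₁ x →L[𝕜] E₂ x}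
    (hg : ContMDiff IB (IB.prod 𝓘(𝕜, F₂ →L[𝕜] F₃)) n
      (fun x ↦ TotalSpace.mk' (F₂ →L[𝕜] F₃) (E := fun x : B ↦ E₂ x →L[𝕜] E₃ x) x (g x)))
    (hf : ContMDiff IB (IB.prod 𝓘(𝕜, F₁ →L[𝕜] F₂)) n
      (fun x ↦ TotalSpace.mk' (F₁ →L[𝕜] F₂) (E := fun x : B ↦ E₁ x →L[𝕜] E₂ x) x (f x))) :
    ContMDiff IB (IB.prod 𝓘(𝕜, F₁ →L[𝕜] F₃)) n
      (fun x ↦ TotalSpace.mk' (F₁ →L[𝕜] F₃) (E := fun x : B ↦ E₁ x →L[𝕜] E₃ x) x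
        ((g x).comp (f x))) := by
  intro x₀
  have hg₀ := (contMDiffAt_hom_bundle _).1 (hg x₀)
  have hf₀ := (contMDiffAt_hom_bundle _).1 (hf x₀)
  refine (contMDiffAt_hom_bundle _).2 ⟨contMDiffAt_id, ?_⟩
  refine (hg₀.2.clm_comp hf₀.2).congr_of_eventuallyEq ?_
  -- Coordinate expressions compose only where all three trivializations at `x₀` are defined; there
  -- the two changes of frame in the middle bundle cancel.
  filter_upwards [(trivializationAt F₁ E₁ x₀).open_baseSet.mem_nhds
      (FiberBundle.mem_baseSet_trivializationAt' x₀),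
    (trivializationAt F₂ E₂ x₀).open_baseSet.mem_nhds
      (FiberBundle.mem_baseSet_trivializationAt' x₀),
    (trivializationAt F₃ E₃ x₀).open_baseSet.mem_nhds
      (FiberBundle.mem_baseSet_trivializationAt' x₀)] with x h₁ h₂ h₃
  rw [inCoordinates_eq h₁ h₃, inCoordinates_eq h₂ h₃, inCoordinates_eq h₁ h₂]
  ext v
  simp only [comp_apply, ContinuousLinearEquiv.coe_coe, ContinuousLinearEquiv.symm_apply_apply]

open ContinuousLinearMap in
/-- The fibrewise inverse of a smooth invertible bundle map is smooth. -/
theorem ContMDiff.clm_bundle_inverse [CompleteSpace F₁]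
    {f : ∀ x, E₁ x →L[𝕜] E₂ x}
    (hf : ContMDiff IB (IB.prod 𝓘(𝕜, F₁ →L[𝕜] F₂)) n
      (fun x ↦ TotalSpace.mk' (F₁ →L[𝕜] F₂) (E := fun x : B ↦ E₁ x →L[𝕜] E₂ x) x (f x)))
    (hinv : ∀ x, (f x).IsInvertible) :
    ContMDiff IB (IB.prod 𝓘(𝕜, F₂ →L[𝕜] F₁)) n
      (fun x ↦ TotalSpace.mk' (F₂ →L[𝕜] F₁) (E := fun x : B ↦ E₂ x →L[𝕜] E₁ x) x
        (f x).inverse) := by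
  intro x₀
  have hf₀ := (contMDiffAt_hom_bundle _).1 (hf x₀)
  refine (contMDiffAt_hom_bundle _).2 ⟨contMDiffAt_id, ?_⟩
  have key : ContMDiffAt IB 𝓘(𝕜, F₂ →L[𝕜] F₁) n
      (ContinuousLinearMap.inverse ∘ fun x ↦ inCoordinates F₁ E₁ F₂ E₂ x₀ x x₀ x (f x)) x₀ := by
    -- In trivializations the bundle map is a function with values in operators `F₁ → F₂`, and
    -- inversion of operators is smooth at an invertible one.
    refine ContMDiffAt.comp x₀ (ContDiffAt.contMDiffAt ?_) hf₀.2
    apply IsInvertible.contDiffAt_map_inverse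
    rw [inCoordinates_eq (FiberBundle.mem_baseSet_trivializationAt' x₀)
      (FiberBundle.mem_baseSet_trivializationAt' x₀)]
    exact isInvertible_equiv.comp ((hinv x₀).comp isInvertible_equiv)
  refine key.congr_of_eventuallyEq ?_
  filter_upwards [(trivializationAt F₁ E₁ x₀).open_baseSet.mem_nhds
      (FiberBundle.mem_baseSet_trivializationAt' x₀),
    (trivializationAt F₂ E₂ x₀).open_baseSet.mem_nhds
      (FiberBundle.mem_baseSet_trivializationAt' x₀)] with x h₁ h₂
  simp only [Function.comp_apply]
  rw [inCoordinates_eq h₁ h₂, inCoordinates_eq h₂ h₁]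
  simp only [inverse_equiv_comp, inverse_comp_equiv, ContinuousLinearEquiv.symm_symm]
  rfl

end BundleMaps

/-! ### Extension of a vector in a fibre to a global smooth section. -/

section Extension

variable {E : Type*} [NormedAddCommGroup E] [NormedSpace ℝ E] [FiniteDimensional ℝ E]
  {M : Type*} [TopologicalSpace M] [T2Space M] [ChartedSpace E M] [IsManifold 𝓘(ℝ, E) ∞ M]
  (F : Type*) [NormedAddCommGroup F] [NormedSpace ℝ F]
  {C : M → Type*} [TopologicalSpace (TotalSpace F C)] [∀ x, TopologicalSpace (C x)]
  [∀ x, AddCommGroup (C x)] [∀ x, Module ℝ (C x)]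
  [FiberBundle F C] [VectorBundle ℝ F C] [ContMDiffVectorBundle ∞ F C 𝓘(ℝ, E)]

/-- A local extension is cut off by a bump function supported where it is smooth. This lets
pointwise statements be tested on global sections. -/
theorem ContMDiffSection.exists_apply_eq (x : M) (v : C x) :
    ∃ e : Cₛ^∞⟮𝓘(ℝ, E); F, C⟯, e x = v := by
  obtain ⟨t, ht, hs⟩ := FiberBundle.exists_contMDiffOn_extend (k := ∞) 𝓘(ℝ, E) F v
  obtain ⟨f, -, hf⟩ := (SmoothBumpFunction.nhds_basis_tsupport (I := 𝓘(ℝ, E)) x).mem_iff.1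
    (interior_mem_nhds.2 ht)
  refine ⟨⟨fun y => f y • FiberBundle.extend F v y, ?_⟩, ?_⟩
  · exact ContMDiffOn.smul_section_of_tsupport f.contMDiff.contMDiffOn isOpen_interior hf
      (hs.mono interior_subset)
  · change f x • FiberBundle.extend F v x = v
    rw [f.eq_one]; simp

end Extension

noncomputable section

namespace TwoPlectic

/-! ## Cartan calculus in terms of smooth functions -/

section Calculus

variable {E : Type*} [NormedAddCommGroup E] [NormedSpace ℝ E]
  {M : Type*} [TopologicalSpace M] [ChartedSpace E M] [IsManifold 𝓘(ℝ, E) ∞ M]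

/-- The function `α(u)`, as a bilinear map. -/
def contractOne : OneForm E M →ₗ[ℝ] VF E M →ₗ[ℝ] SmoothFn E M :=
  LinearMap.mk₂ ℝ
    (fun α u => ⟨evalOne α u, fun y => by
      have := (α.contMDiff).clm_bundle_apply (v := fun m => u m) u.contMDiff y
      simp only [contMDiffAt_section] at this
      exact this⟩)
    (fun _ _ _ => rfl) (fun _ _ _ => rfl)
    (fun α u w => by ext x; exact map_add (α x) (u x) (w x))
    (fun c α u => by ext x; exact map_smul (α x) c (u x))

/-- The de Rham differential of a function. -/
def dForm : SmoothFn E M →ₗ[ℝ] OneForm E M where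
  toFun f := ⟨fun x => mfderiv 𝓘(ℝ, E) 𝓘(ℝ, ℝ) f x, by
    intro x₀
    refine (contMDiffAt_hom_bundle _).2 ⟨contMDiffAt_id, ?_⟩
    -- The differential loses one derivative, which is harmless because `∞ + 1 = ∞`.
    refine ((f.contMDiff x₀).mfderiv_const (m := ∞) le_rfl).congr_of_eventuallyEq ?_
    filter_upwards [(trivializationAt E (TangentSpace 𝓘(ℝ, E)) x₀).open_baseSet.mem_nhds
      (FiberBundle.mem_baseSet_trivializationAt' x₀)] with x hx
    ext v
    simp [inTangentCoordinates, ContinuousLinearMap.inCoordinates]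
    rfl⟩
  map_add' f g := by
    ext x v
    exact congrArg (fun φ => φ v) (mfderiv_add (f.contMDiff.mdifferentiable (by simp) x)
      (g.contMDiff.mdifferentiable (by simp) x))
  map_smul' c f := by
    ext x v
    exact congrArg (fun φ => φ v) (const_smul_mfderiv (f.contMDiff.mdifferentiable (by simp) x) c)

/-- The derivative `u(f)` of a function along a vector field, as a bilinear map. -/
def lieDeriv : VF E M →ₗ[ℝ] SmoothFn E M →ₗ[ℝ] SmoothFn E M :=
  (contractOne ∘ₗ dForm).flip

@[simp]
theorem lieDeriv_apply (u : VF E M) (f : SmoothFn E M) (x : M) :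
    lieDeriv u f x = dirDeriv u f x := rfl

/-- The 1-form `ω(u, v, ·)`, as a bilinear map. -/
def ThreeForm.contractTwo (Ω : ThreeForm E M) : VF E M →ₗ[ℝ] VF E M →ₗ[ℝ] OneForm E M :=
  LinearMap.mk₂ ℝ
    (fun u v => ⟨fun x => Ω.toSection x (u x) (v x),
      ((Ω.toSection.contMDiff).clm_bundle_apply u.contMDiff).clm_bundle_apply v.contMDiff⟩)
    (fun u u' v => ContMDiffSection.ext fun x =>
      congrArg (fun φ => φ (v x)) (map_add (Ω.toSection x) (u x) (u' x)))
    (fun c u v => ContMDiffSection.ext fun x =>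
      congrArg (fun φ => φ (v x)) (map_smul (Ω.toSection x) c (u x)))
    (fun u v v' => ContMDiffSection.ext fun x => map_add (Ω.toSection x (u x)) (v x) (v' x))
    (fun c u v => ContMDiffSection.ext fun x => map_smul (Ω.toSection x (u x)) c (v x))

/-- The function `ω(u, v, w)`, as a trilinear map. -/
def ThreeForm.fn (Ω : ThreeForm E M) :
    VF E M →ₗ[ℝ] VF E M →ₗ[ℝ] VF E M →ₗ[ℝ] SmoothFn E M :=
  Ω.contractTwo.compr₂ contractOne

theorem ThreeForm.fn_eq (Ω : ThreeForm E M) (u v w : VF E M) :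
    Ω.fn u v w = contractOne (Ω.contractTwo u v) w := rfl

/-- Polarization of the alternating condition at `u + v`. -/
theorem ThreeForm.fn_swap_left (Ω : ThreeForm E M) (u v w : VF E M) :
    Ω.fn u v w = -Ω.fn v u w := by
  have h : Ω.fn (u + v) (u + v) w = 0 := ContMDiffMap.ext fun x => Ω.alternating_left x _ _
  have hu : Ω.fn u u w = 0 := ContMDiffMap.ext fun x => Ω.alternating_left x _ _
  have hv : Ω.fn v v w = 0 := ContMDiffMap.ext fun x => Ω.alternating_left x _ _
  simp only [map_add, LinearMap.add_apply, hu, hv] at h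
  linear_combination h

theorem ThreeForm.fn_swap_right (Ω : ThreeForm E M) (u v w : VF E M) :
    Ω.fn u v w = -Ω.fn u w v := by
  have h : Ω.fn u (v + w) (v + w) = 0 := ContMDiffMap.ext fun x => Ω.alternating_right x _ _
  have hu : Ω.fn u v v = 0 := ContMDiffMap.ext fun x => Ω.alternating_right x _ _
  have hv : Ω.fn u w w = 0 := ContMDiffMap.ext fun x => Ω.alternating_right x _ _
  simp only [map_add, LinearMap.add_apply, hu, hv] at h
  linear_combination h

theorem ThreeForm.fn_rotate (Ω : ThreeForm E M) (u v w : VF E M) :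
    Ω.fn u v w = Ω.fn v w u := by
  rw [Ω.fn_swap_left, Ω.fn_swap_right, neg_neg]

section

variable [FiniteDimensional ℝ E]

/-- The Lie bracket of smooth vector fields, as a smooth vector field. -/
def lieBracketVF (u w : VF E M) : VF E M :=
  have := FiniteDimensional.complete ℝ E
  have : IsManifold 𝓘(ℝ, E) (minSmoothness ℝ 2) M := .of_le (n := ∞)
    (by simpa using ENat.LEInfty.out)
  have : IsManifold 𝓘(ℝ, E) (((⊤ : ℕ∞) : WithTop ℕ∞) + 1) M := inferInstanceAs (IsManifold _ ∞ M)
  ⟨mlieBracket 𝓘(ℝ, E) u w,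
    ContDiff.mlieBracket_vectorField (m := ⊤) (n := ⊤) u.contMDiff w.contMDiff (by simp)⟩

theorem lieBracketVF_swap (u w : VF E M) : lieBracketVF u w = -lieBracketVF w u :=
  ContMDiffSection.ext fun _ => mlieBracket_swap_apply

theorem lieBracketVF_fsmul (u w : VF E M) (f : SmoothFn E M) :
    lieBracketVF u (fsmul f w) = fsmul (lieDeriv u f) w + fsmul f (lieBracketVF u w) := by
  have := FiniteDimensional.complete ℝ E
  exact ContMDiffSection.ext fun x =>
    mlieBracket_smul_right (f.contMDiff.mdifferentiable (by simp) x) w.mdifferentiableAt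

theorem lieBracketVF_add (u w w' : VF E M) :
    lieBracketVF u (w + w') = lieBracketVF u w + lieBracketVF u w' := by
  have := FiniteDimensional.complete ℝ E
  exact ContMDiffSection.ext fun x =>
    mlieBracket_add_right w.mdifferentiableAt w'.mdifferentiableAt

theorem lieBracketVF_leibniz (u v w : VF E M) :
    lieBracketVF u (lieBracketVF v w)
      = lieBracketVF (lieBracketVF u v) w + lieBracketVF v (lieBracketVF u w) := by
  have := FiniteDimensional.complete ℝ E
  have : IsManifold 𝓘(ℝ, E) (minSmoothness ℝ 3) M := .of_le (n := ∞)
    (by simpa using ENat.LEInfty.out)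
  have h (u : VF E M) :=
    u.contMDiff.of_le (m := minSmoothness ℝ 2) (by simpa using ENat.LEInfty.out)
  exact ContMDiffSection.coe_injective (leibniz_identity_mlieBracket (h u) (h v) (h w))

theorem exists_vf_apply_eq [T2Space M] (x : M) (v : TangentSpace 𝓘(ℝ, E) x) :
    ∃ u : VF E M, u x = v :=
  ContMDiffSection.exists_apply_eq E x v

/-- This follows from the Jacobi identity for vector fields applied to `u`, `w` and `f y`: after
expansion by the Leibniz rule, the coefficients of `y` must agree, and `y` can be chosen nonzero at
the given point. -/
theorem lieDeriv_lieBracketVF [T2Space M] (u w : VF E M) (f : SmoothFn E M) :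
    lieDeriv (lieBracketVF u w) f = lieDeriv u (lieDeriv w f) - lieDeriv w (lieDeriv u f) := by
  ext x
  -- In dimension zero there is no nonzero `y`, but all derivatives vanish.
  rcases subsingleton_or_nontrivial E with hE | hE
  · have h (y : VF E M) : y x = 0 := Subsingleton.elim (α := E) _ _
    have h' (y : VF E M) (g : SmoothFn E M) : lieDeriv y g x = 0 := by
      rw [lieDeriv_apply, dirDeriv, h, map_zero]; rfl
    rw [ContMDiffMap.coe_sub, Pi.sub_apply, h', h', h', sub_zero]
  · obtain ⟨z, hz⟩ := exists_ne (0 : E)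
    obtain ⟨y, hy⟩ := exists_vf_apply_eq x (z : TangentSpace 𝓘(ℝ, E) x)
    have key := lieBracketVF_leibniz u w (fsmul f y)
    simp only [lieBracketVF_fsmul, lieBracketVF_add] at key
    rw [lieBracketVF_leibniz u w y] at key
    have key := congrArg (fun v : VF E M => v x) key
    simp only [fsmul, ContMDiffSection.coe_add, Pi.add_apply, ContMDiffSection.coeFn_mk, hy]
      at key
    -- The terms in `[u, y]`, `[w, y]` and the iterated brackets cancel, leaving a multiple of `z =
    -- y(x)`.
    have aux {V : Type _} [AddCommGroup V] [Module ℝ V] {a b c d r t : ℝ} {z p q m k : V}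
        (h : a • z + b • p + (c • q + r • (m + k))
          = d • z + r • m + (t • z + c • q + (b • p + r • k))) : (d - (a - t)) • z = 0 := by
      linear_combination (norm := module) -h
    have : (lieDeriv (lieBracketVF u w) f x - (lieDeriv u (lieDeriv w f) x
        - lieDeriv w (lieDeriv u f) x)) • (z : TangentSpace 𝓘(ℝ, E) x) = 0 := by
      exact aux key
    exact sub_eq_zero.1 ((smul_eq_zero.1 this).resolve_right hz)

end

end Calculus

/-! ## Constructions of Lie 2-algebras and of their isomorphisms -/

namespace LieTwoAlgebra

variable {L₀ L₁ L₀' L₁' : Type*}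
  [AddCommGroup L₀] [Module ℝ L₀] [AddCommGroup L₁] [Module ℝ L₁]
  [AddCommGroup L₀'] [Module ℝ L₀'] [AddCommGroup L₁'] [Module ℝ L₁']

theorem eq_of_operations_eq {A B : LieTwoAlgebra L₀ L₁} (hd : ∀ f, A.d f = B.d f)
    (hb : ∀ x y, A.bracket x y = B.bracket x y) (ha : ∀ x f, A.act x f = B.act x f)
    (hj : ∀ x y z, A.jac x y z = B.jac x y z) : A = B := by
  replace hd := LinearMap.ext hd
  replace hb := LinearMap.ext₂ hb
  replace ha := LinearMap.ext₂ ha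
  replace hj : A.jac = B.jac := LinearMap.ext fun x => LinearMap.ext₂ (hj x)
  cases A
  cases B
  simp only at hd hb ha hj
  subst hd hb ha hj
  rfl

/-- Operations on a 2-term complex which are intertwined with those of a Lie 2-algebra by an
injective linear map, up to the homotopy `Φ`, form a Lie 2-algebra. -/
def pullback (B : LieTwoAlgebra L₀' L₁') (d : L₁ →ₗ[ℝ] L₀) (b : L₀ →ₗ[ℝ] L₀ →ₗ[ℝ] L₀)
    (a : L₀ →ₗ[ℝ] L₁ →ₗ[ℝ] L₁) (j : L₀ →ₗ[ℝ] L₀ →ₗ[ℝ] L₀ →ₗ[ℝ] L₁)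
    (p : L₀ →ₗ[ℝ] L₀') (q : L₁ →ₗ[ℝ] L₁') (Φ : L₀ →ₗ[ℝ] L₀ →ₗ[ℝ] L₁')
    (hp : Function.Injective p) (hq : Function.Injective q)
    (hΦ : ∀ x y, Φ x y = -Φ y x)
    (hd : ∀ f, p (d f) = B.d (q f))
    (hb : ∀ x y, p (b x y) = B.bracket (p x) (p y) + B.d (Φ x y))
    (ha : ∀ x f, q (a x f) = B.act (p x) (q f) + Φ x (d f))
    (hj : ∀ x y z, q (j x y z) = B.jac (p x) (p y) (p z) + (Φ x (b y z) - Φ (b x y) z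
      - Φ y (b x z) + B.act (p z) (Φ x y) + B.act (p x) (Φ y z) - B.act (p y) (Φ x z))) :
    LieTwoAlgebra L₀ L₁ :=
  -- Each axiom is an equation in `L₀` or `L₁`, so it suffices to check it after applying the
  -- injective `p` or `q`, where it becomes an axiom of `B` plus terms in `Φ` that cancel.
  have hskew x y : b x y = -b y x := hp <| by
    rw [map_neg, hb, hb, B.bracket_skew (p x), hΦ x, map_neg, neg_add]
  have hd_act x f : d (a x f) = b x (d f) := hp <| by
    rw [hd, ha, hb, map_add, B.d_act, hd]
  have hjacobi x y z : b x (b y z) - (b (b x y) z + b y (b x z)) = d (j x y z) := hp <| by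
    simp only [map_sub, map_add, hb, hd, hj, LinearMap.add_apply, ← B.jacobi, B.d_act,
      B.bracket_skew (B.d _) (p z)]
    abel
  have B_act_d f g : B.act (B.d f) g = -B.act (B.d g) f := B.act_d f g
  { d := d
    bracket := b
    act := a
    jac := j
    bracket_skew := hskew
    d_act := hd_act
    act_d := fun f g => hq <| by
      rw [map_neg, ha, ha, hd, hd, B.act_d (q f), hΦ (d f), neg_add]
    jac_skew_left := fun x y z => hq <| by
      rw [map_neg, hj, hj, B.jac_skew_left (p x), hskew x y, hΦ x y]
      simp only [map_neg, LinearMap.neg_apply]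
      abel
    jac_skew_right := fun x y z => hq <| by
      rw [map_neg, hj, hj, B.jac_skew_right (p x), hskew y z, hΦ y z, hΦ (b x y) z, hΦ y (b x z)]
      simp only [map_neg]
      abel
    jacobi := hjacobi
    jacobi_act := fun x y f => hq <| by
      simp only [map_sub, map_add, ha, hb, hj, LinearMap.add_apply, hd_act, hd, ← B.jacobi_act,
        B_act_d (q f)]
      abel
    coherence := fun x y z w => hq <| by
      -- Correction terms `B.d (Φ _ _)` inside a Jacobiator are moved to the last slot, where
      -- `B.jacobi_act` turns them into iterated actions.
      have cyc u v f : B.jac (B.d f) u v = B.jac u v (B.d f) := by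
        rw [B.jac_skew_left, B.jac_skew_right, neg_neg]
      have key := B.coherence (p x) (p y) (p z) (p w)
      simp only [map_sub, map_add, map_neg, ha, hb, hj, LinearMap.add_apply, ← hjacobi,
        cyc, B.jac_skew_right _ (B.d _) (p w), ← B.jacobi_act]
      rw [hΦ (b x (b y z)) w, hΦ (b (b x y) z) w, hΦ (b y (b x z)) w, B_act_d (Φ y z),
        B_act_d (Φ y w), B_act_d (Φ z w)]
      rw [← sub_eq_zero] at key ⊢
      rw [← key]
      abel }

/-- A morphism of Lie 2-algebras from maps which intertwine the operations up to `Φ`. -/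
def Hom.ofIntertwining {A : LieTwoAlgebra L₀ L₁} {B : LieTwoAlgebra L₀' L₁'}
    (p : L₀ →ₗ[ℝ] L₀') (q : L₁ →ₗ[ℝ] L₁') (Φ : L₀ →ₗ[ℝ] L₀ →ₗ[ℝ] L₁')
    (hΦ : ∀ x y, Φ x y = -Φ y x)
    (hd : ∀ f, p (A.d f) = B.d (q f))
    (hb : ∀ x y, p (A.bracket x y) = B.bracket (p x) (p y) + B.d (Φ x y))
    (ha : ∀ x f, q (A.act x f) = B.act (p x) (q f) + Φ x (A.d f))
    (hj : ∀ x y z, q (A.jac x y z) = B.jac (p x) (p y) (p z) + (Φ x (A.bracket y z)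
      - Φ (A.bracket x y) z - Φ y (A.bracket x z) + B.act (p z) (Φ x y) + B.act (p x) (Φ y z)
      - B.act (p y) (Φ x z))) : A.Hom B where
  φ₀ := p
  φ₁ := q
  Φ := Φ
  comm_d := hd
  Φ_skew := hΦ
  map_bracket x y := sub_eq_iff_eq_add'.2 (hb x y)
  map_act x f := sub_eq_iff_eq_add'.2 (ha x f)
  coherence x y z := by rw [hj]; abel

/-- A morphism which is bijective in both degrees is an isomorphism. -/
theorem Hom.isomorphic {A : LieTwoAlgebra L₀ L₁} {B : LieTwoAlgebra L₀' L₁'} (F : A.Hom B)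
    (h₀ : Function.Bijective F.φ₀) (h₁ : Function.Bijective F.φ₁) : A.Isomorphic B := by
  let e₀ := LinearEquiv.ofBijective F.φ₀ h₀
  let e₁ := LinearEquiv.ofBijective F.φ₁ h₁
  have he₀ x : F.φ₀ (e₀.symm x) = x := e₀.apply_symm_apply x
  have he₁ x : F.φ₁ (e₁.symm x) = x := e₁.apply_symm_apply x
  have he₀' x : e₀.symm (F.φ₀ x) = x := e₀.symm_apply_apply x
  have he₁' x : e₁.symm (F.φ₁ x) = x := e₁.symm_apply_apply x
  -- The condition `Ψ(φ₀ x, φ₀ y) + φ₁⁻¹ Φ(x, y) = 0` on the composite forces this choice.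
  let Ψ : L₀' →ₗ[ℝ] L₀' →ₗ[ℝ] L₁ :=
    -(F.Φ.compl₁₂ e₀.symm.toLinearMap e₀.symm.toLinearMap).compr₂ e₁.symm.toLinearMap
  have hΨ x y : Ψ x y = -e₁.symm (F.Φ (e₀.symm x) (e₀.symm y)) := rfl
  have hΨ' x y : F.φ₁ (Ψ x y) = -F.Φ (e₀.symm x) (e₀.symm y) := by rw [hΨ, map_neg, he₁]
  have hd f : e₀.symm (B.d f) = A.d (e₁.symm f) := h₀.1 <| by rw [he₀, F.comm_d, he₁]
  have hb x y : F.φ₀ (A.bracket x y) = B.bracket (F.φ₀ x) (F.φ₀ y) + B.d (F.Φ x y) :=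
    sub_eq_iff_eq_add'.1 (F.map_bracket x y)
  have ha x f : F.φ₁ (A.act x f) = B.act (F.φ₀ x) (F.φ₁ f) + F.Φ x (A.d f) :=
    sub_eq_iff_eq_add'.1 (F.map_act x f)
  have hb' x y : e₀.symm (B.bracket x y)
      = A.bracket (e₀.symm x) (e₀.symm y) + A.d (Ψ x y) := h₀.1 <| by
    rw [he₀, map_add, hb, he₀, he₀, F.comm_d, hΨ', map_neg, add_neg_cancel_right]
  let G : B.Hom A := Hom.ofIntertwining e₀.symm.toLinearMap e₁.symm.toLinearMap Ψ
    (fun x y => by rw [hΨ, hΨ, F.Φ_skew, map_neg])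
    hd hb'
    (fun x f => h₁.1 <| by
      simp only [LinearEquiv.coe_coe, map_add, he₁, ha, he₀, hΨ', hd, add_neg_cancel_right])
    (fun x y z => h₁.1 <| by
      have key := F.coherence (e₀.symm x) (e₀.symm y) (e₀.symm z)
      simp only [LinearEquiv.coe_coe, map_add, map_sub, map_neg, LinearMap.add_apply, he₁, ha, he₀,
        hΨ', hb'] at key ⊢
      rw [sub_eq_iff_eq_add] at key
      rw [key, F.Φ_skew (A.d (Ψ x y))]
      abel)
  refine ⟨F, G, ⟨he₀', he₁', fun x y => ?_⟩, he₀, he₁, fun x y => ?_⟩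
  · change Ψ _ _ + e₁.symm _ = 0
    rw [hΨ, he₀', he₀', neg_add_cancel]
  · change F.Φ (e₀.symm x) (e₀.symm y) + F.φ₁ (Ψ x y) = 0
    rw [hΨ', add_neg_cancel]

theorem Isomorphic.symm {A : LieTwoAlgebra L₀ L₁} {B : LieTwoAlgebra L₀' L₁'}
    (h : A.Isomorphic B) : B.Isomorphic A := by
  obtain ⟨F, G, hFG, hGF⟩ := h
  exact ⟨G, F, hGF, hFG⟩

end LieTwoAlgebra

/-! ## The Lie 2-algebra of Hamiltonian 1-forms -/

section Hamiltonian

variable {E : Type*} [NormedAddCommGroup E] [NormedSpace ℝ E] [FiniteDimensional ℝ E]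
  {M : Type*} [TopologicalSpace M] [T2Space M] [ChartedSpace E M] [IsManifold 𝓘(ℝ, E) ∞ M]

theorem oneForm_ext {α β : OneForm E M} (h : ∀ u, contractOne α u = contractOne β u) :
    α = β := by
  ext x v
  obtain ⟨u, rfl⟩ := exists_vf_apply_eq x v
  exact congrArg (fun f : SmoothFn E M => f x) (h u)

theorem contractOne_dForm (f : SmoothFn E M) (u : VF E M) :
    contractOne (dForm f) u = lieDeriv u f := rfl

namespace ThreeForm

variable {Ω : ThreeForm E M}

theorem isHamiltonianVF_iff {α : OneForm E M} {v : VF E M} :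
    Ω.IsHamiltonianVF α v ↔ ∀ u w, lieDeriv u (contractOne α w) - lieDeriv w (contractOne α u)
      - contractOne α (lieBracketVF u w) = -Ω.fn v u w :=
  ⟨fun h u w => ContMDiffMap.ext fun x => h u w x,
    fun h u w x => congrArg (fun f : SmoothFn E M => f x) (h u w)⟩

/-- Nondegeneracy is a condition on tangent vectors; it applies because every tangent vector extends
to a vector field. -/
theorem vf_ext (hΩ : Ω.IsTwoPlectic) {v v' : VF E M} (h : ∀ u w, Ω.fn v u w = Ω.fn v' u w) :
    v = v' := by
  refine ContMDiffSection.ext fun x => sub_eq_zero.1 (hΩ.nondegenerate x _ fun a b => ?_)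
  obtain ⟨u, rfl⟩ := exists_vf_apply_eq x a
  obtain ⟨w, rfl⟩ := exists_vf_apply_eq x b
  have key : Ω.fn (v - v') u w = 0 := by
    rw [map_sub, LinearMap.sub_apply, LinearMap.sub_apply, h, sub_self]
  exact congrArg (fun f : SmoothFn E M => f x) key

theorem IsHamiltonianVF.unique (hΩ : Ω.IsTwoPlectic) {α : OneForm E M} {v v' : VF E M}
    (h : Ω.IsHamiltonianVF α v) (h' : Ω.IsHamiltonianVF α v') : v = v' :=
  vf_ext hΩ fun u w => by
    rw [← neg_inj, ← isHamiltonianVF_iff.1 h, isHamiltonianVF_iff.1 h']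

/-- This is `d² = 0` on functions. -/
theorem isHamiltonianVF_dForm (f : SmoothFn E M) : Ω.IsHamiltonianVF (dForm f) 0 :=
  isHamiltonianVF_iff.2 fun u w => by
    simp only [contractOne_dForm, lieDeriv_lieBracketVF, map_zero, LinearMap.zero_apply, neg_zero,
      sub_self]

theorem IsTwoPlectic.closed_fn (hΩ : Ω.IsTwoPlectic) (a b c e : VF E M) :
    lieDeriv a (Ω.fn b c e) - lieDeriv b (Ω.fn a c e) + lieDeriv c (Ω.fn a b e)
      - lieDeriv e (Ω.fn a b c) - Ω.fn (lieBracketVF a b) c e + Ω.fn (lieBracketVF a c) b e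
      - Ω.fn (lieBracketVF a e) b c - Ω.fn (lieBracketVF b c) a e
      + Ω.fn (lieBracketVF b e) a c - Ω.fn (lieBracketVF c e) a b = 0 :=
  ContMDiffMap.ext fun x => hΩ.closed a b c e x

/-- The 2-form `ι_v ω` is closed, if `v` is a Hamiltonian vector field. -/
theorem IsHamiltonianVF.closed {α : OneForm E M} {v : VF E M} (h : Ω.IsHamiltonianVF α v)
    (a b c : VF E M) :
    lieDeriv a (Ω.fn v b c) - lieDeriv b (Ω.fn v a c) + lieDeriv c (Ω.fn v a b)
      - Ω.fn v (lieBracketVF a b) c + Ω.fn v (lieBracketVF a c) b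
      - Ω.fn v (lieBracketVF b c) a = 0 := by
  have h' a b : Ω.fn v a b = -(lieDeriv a (contractOne α b) - lieDeriv b (contractOne α a)
      - contractOne α (lieBracketVF a b)) := by rw [isHamiltonianVF_iff.1 h, neg_neg]
  -- Since `ι_v ω = -dα`, the claim is `d(dα) = 0`. Second derivatives cancel by the commutator
  -- formula, and the values of `α` on iterated brackets by the Jacobi identity.
  have hJ := congrArg (contractOne α) (lieBracketVF_leibniz a b c)
  rw [lieBracketVF_swap a, lieBracketVF_swap b (lieBracketVF a c)] at hJ
  simp only [h', map_neg, map_sub, map_add, lieDeriv_lieBracketVF] at hJ ⊢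
  linear_combination hJ

/-- Hamiltonian vector fields preserve `ω`. -/
theorem IsHamiltonianVF.lieDeriv_fn (hΩ : Ω.IsTwoPlectic) {α : OneForm E M} {v : VF E M}
    (h : Ω.IsHamiltonianVF α v) (a b c : VF E M) :
    lieDeriv v (Ω.fn a b c) = Ω.fn (lieBracketVF v a) b c + Ω.fn a (lieBracketVF v b) c
      + Ω.fn a b (lieBracketVF v c) := by
  -- Cartan's formula `L_v ω = ι_v dω + d ι_v ω`, in which both summands vanish.
  have h₁ := hΩ.closed_fn v a b c
  have h₂ := h.closed a b c
  rw [Ω.fn_swap_left (lieBracketVF v b), Ω.fn_rotate (lieBracketVF v c),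
    Ω.fn_swap_left (lieBracketVF a b), Ω.fn_swap_left (lieBracketVF a c),
    Ω.fn_swap_left (lieBracketVF b c)] at h₁
  linear_combination h₁ + h₂

/-- The Lie bracket of the Hamiltonian vector fields of `α` and `β` is the Hamiltonian vector
field of `{α, β}`. -/
theorem IsHamiltonianVF.contractTwo (hΩ : Ω.IsTwoPlectic) {α β : OneForm E M} {u v : VF E M}
    (hu : Ω.IsHamiltonianVF α u) (hv : Ω.IsHamiltonianVF β v) :
    Ω.IsHamiltonianVF (Ω.contractTwo u v) (lieBracketVF u v) :=
  isHamiltonianVF_iff.2 fun a b => by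
    -- In Cartan calculus: `ι_[u,v] ω = L_u ι_v ω` as `L_u ω = 0`, and this is `d ι_u ι_v ω` as `ι_v
    -- ω` is closed.
    have h₁ := hu.lieDeriv_fn hΩ v a b
    have h₂ := hv.closed u a b
    simp only [← fn_eq]
    rw [Ω.fn_swap_right v (lieBracketVF u b), Ω.fn_swap_left v u, Ω.fn_swap_left v u,
      ← Ω.fn_rotate u v, map_neg, map_neg] at h₂
    linear_combination h₂ - h₁

/-- The failure of the bracket of Hamiltonian 1-forms to satisfy the Jacobi identity. -/
theorem IsHamiltonianVF.lieDeriv_fn_eq (hΩ : Ω.IsTwoPlectic) {α β γ : OneForm E M} {u v w : VF E M}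
    (hu : Ω.IsHamiltonianVF α u) (hv : Ω.IsHamiltonianVF β v) (hw : Ω.IsHamiltonianVF γ w)
    (a : VF E M) :
    lieDeriv a (Ω.fn u v w) = Ω.fn (lieBracketVF u v) w a + Ω.fn v (lieBracketVF u w) a
      - Ω.fn u (lieBracketVF v w) a := by
  -- Both `h₁` and `h₂` contain `w(ω(u, v, a)) - ω(u, v, [w, a])`; eliminating it leaves the claim.
  have h₁ := isHamiltonianVF_iff.1 (hu.contractTwo hΩ hv) w a
  have h₂ := hw.lieDeriv_fn hΩ u v a
  simp only [← fn_eq] at h₁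
  rw [lieBracketVF_swap w u, lieBracketVF_swap w v, map_neg, map_neg, LinearMap.neg_apply,
    LinearMap.neg_apply, LinearMap.neg_apply, Ω.fn_swap_left (lieBracketVF u w)] at h₂
  linear_combination h₂ - h₁

theorem IsHamiltonianVF.add {α β : OneForm E M} {u v : VF E M} (hu : Ω.IsHamiltonianVF α u)
    (hv : Ω.IsHamiltonianVF β v) : Ω.IsHamiltonianVF (α + β) (u + v) :=
  isHamiltonianVF_iff.2 fun a b => by
    have hα := isHamiltonianVF_iff.1 hu a b
    have hβ := isHamiltonianVF_iff.1 hv a b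
    simp only [map_add, LinearMap.add_apply]
    linear_combination hα + hβ

variable (hΩ : Ω.IsTwoPlectic)

/-- The Hamiltonian vector field of a Hamiltonian 1-form, as a linear map. -/
def hamiltonianVF : Ω.hamiltonianForms →ₗ[ℝ] VF E M where
  toFun α := α.2.choose
  map_add' α β := IsHamiltonianVF.unique hΩ (α + β).2.choose_spec <|
    α.2.choose_spec.add β.2.choose_spec
  map_smul' c α := IsHamiltonianVF.unique hΩ (c • α).2.choose_spec <|
    isHamiltonianVF_iff.2 fun u w => by
      have hα := isHamiltonianVF_iff.1 α.2.choose_spec u w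
      simp only [Submodule.coe_smul, map_smul, LinearMap.smul_apply, RingHom.id_apply,
        ← smul_sub, ← smul_neg, hα]

theorem isHamiltonianVF_hamiltonianVF (α : Ω.hamiltonianForms) :
    Ω.IsHamiltonianVF (α : OneForm E M) (hamiltonianVF hΩ α) := α.2.choose_spec

theorem hamiltonianVF_eq {α : Ω.hamiltonianForms} {v : VF E M}
    (h : Ω.IsHamiltonianVF (α : OneForm E M) v) : hamiltonianVF hΩ α = v :=
  (isHamiltonianVF_hamiltonianVF hΩ α).unique hΩ h

/-- The Lie 2-algebra `L_∞(M, ω)`. -/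
def hamiltonianLieTwoAlgebra : LieTwoAlgebra Ω.hamiltonianForms (SmoothFn E M) :=
  let V := hamiltonianVF hΩ
  have hV (α : Ω.hamiltonianForms) : Ω.IsHamiltonianVF (α : OneForm E M) (V α) :=
    isHamiltonianVF_hamiltonianVF hΩ α
  have hd f : V ⟨dForm f, 0, isHamiltonianVF_dForm f⟩ = 0 :=
    hamiltonianVF_eq hΩ (isHamiltonianVF_dForm f)
  have hb α β : V ⟨Ω.contractTwo (V α) (V β), _, (hV α).contractTwo hΩ (hV β)⟩
      = lieBracketVF (V α) (V β) :=
    hamiltonianVF_eq hΩ ((hV α).contractTwo hΩ (hV β))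
  { d := dForm.codRestrict _ fun f => ⟨0, isHamiltonianVF_dForm f⟩
    bracket := LinearMap.mk₂ ℝ
      (fun α β => ⟨Ω.contractTwo (V α) (V β), _, (hV α).contractTwo hΩ (hV β)⟩)
      (fun α α' β => Subtype.ext <| by
        simp only [map_add, LinearMap.add_apply, Submodule.coe_add])
      (fun c α β => Subtype.ext <| by
        simp only [map_smul, LinearMap.smul_apply, Submodule.coe_smul])
      (fun α β β' => Subtype.ext <| by simp only [map_add, Submodule.coe_add])
      (fun c α β => Subtype.ext <| by simp only [map_smul, Submodule.coe_smul])
    act := 0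
    -- Reversing three arguments is an odd permutation, so this is `ω(v_γ, v_β, v_α)`.
    jac := LinearMap.mk₂ ℝ (fun α β => -(Ω.fn (V α) (V β) ∘ₗ V))
      (fun α α' β => by
        ext1 γ
        simp only [map_add, LinearMap.add_apply, LinearMap.neg_apply, LinearMap.comp_apply]
        ring)
      (fun c α β => by
        ext1 γ
        simp only [map_smul, LinearMap.smul_apply, LinearMap.neg_apply, LinearMap.comp_apply,
          smul_neg])
      (fun α β β' => by
        ext1 γ
        simp only [map_add, LinearMap.add_apply, LinearMap.neg_apply, LinearMap.comp_apply]
        ring)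
      (fun c α β => by
        ext1 γ
        simp only [map_smul, LinearMap.smul_apply, LinearMap.neg_apply, LinearMap.comp_apply,
          smul_neg])
    bracket_skew := fun α β => Subtype.ext <| oneForm_ext fun w => by
      simp only [LinearMap.mk₂_apply, Submodule.coe_neg, map_neg, LinearMap.neg_apply, ← fn_eq]
      exact Ω.fn_swap_left _ _ _
    d_act := fun α f => Subtype.ext <| oneForm_ext fun w => by
      simp only [LinearMap.zero_apply, map_zero, LinearMap.mk₂_apply, LinearMap.codRestrict,
        LinearMap.coe_mk, AddHom.coe_mk, hd, Submodule.coe_zero]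
    act_d := fun f g => by simp only [LinearMap.zero_apply, neg_zero]
    jac_skew_left := fun α β γ => by
      simp only [LinearMap.mk₂_apply, LinearMap.neg_apply, LinearMap.comp_apply, neg_inj]
      exact Ω.fn_swap_left _ _ _
    jac_skew_right := fun α β γ => by
      simp only [LinearMap.mk₂_apply, LinearMap.neg_apply, LinearMap.comp_apply, neg_inj]
      exact Ω.fn_swap_right _ _ _
    jacobi := fun α β γ => Subtype.ext <| oneForm_ext fun w => by
      have key := (hV α).lieDeriv_fn_eq hΩ (hV β) (hV γ) w
      simp only [LinearMap.mk₂_apply, LinearMap.codRestrict, LinearMap.coe_mk, AddHom.coe_mk, hb,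
        Submodule.coe_sub, Submodule.coe_add, Submodule.coe_neg, map_sub, map_add,
        LinearMap.sub_apply, map_neg, LinearMap.neg_apply, LinearMap.add_apply, ← fn_eq,
        contractOne_dForm, LinearMap.comp_apply]
      linear_combination key
    jacobi_act := fun α β f => by
      simp only [LinearMap.zero_apply, map_zero, LinearMap.mk₂_apply, LinearMap.codRestrict,
        LinearMap.coe_mk, AddHom.coe_mk, hd, LinearMap.neg_apply, LinearMap.comp_apply]
      simp
    coherence := fun α β γ δ => by
      -- As the action is zero, the coherence law compares two expressions for `v_α(ω(v_β, v_γ,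
      -- v_δ))`: invariance of `ω` under `v_α`, and the Jacobi defect of `β, γ, δ`.
      have h₁ := (hV α).lieDeriv_fn hΩ (V β) (V γ) (V δ)
      have h₂ := (hV β).lieDeriv_fn_eq hΩ (hV γ) (hV δ) (V α)
      simp only [LinearMap.zero_apply, LinearMap.mk₂_apply, hb, LinearMap.neg_apply,
        LinearMap.comp_apply]
      rw [Ω.fn_rotate (V α), Ω.fn_rotate (V α), Ω.fn_rotate (V α)]
      linear_combination h₂ - h₁ }

theorem isHamiltonianLieTwoAlgebra :
    Ω.IsHamiltonianLieTwoAlgebra (hamiltonianLieTwoAlgebra hΩ) where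
  d_eq f x w := rfl
  bracket_eq α β u v hu hv x w := by
    rw [← hamiltonianVF_eq hΩ hu, ← hamiltonianVF_eq hΩ hv]
    rfl
  act_eq α f := rfl
  jac_eq α β γ u v w hu hv hw x := by
    rw [← hamiltonianVF_eq hΩ hu, ← hamiltonianVF_eq hΩ hv, ← hamiltonianVF_eq hΩ hw]
    have h : (hamiltonianLieTwoAlgebra hΩ).jac α β γ
        = Ω.fn (hamiltonianVF hΩ γ) (hamiltonianVF hΩ β) (hamiltonianVF hΩ α) := by
      rw [Ω.fn_swap_left, ← Ω.fn_rotate]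
      rfl
    rw [h]
    rfl

theorem IsHamiltonianLieTwoAlgebra.unique {A A' : LieTwoAlgebra Ω.hamiltonianForms (SmoothFn E M)}
    (hA : Ω.IsHamiltonianLieTwoAlgebra A) (hA' : Ω.IsHamiltonianLieTwoAlgebra A') : A = A' := by
  refine LieTwoAlgebra.eq_of_operations_eq (fun f => ?_) (fun α β => ?_) (fun α f => ?_)
    fun α β γ => ?_
  · ext x w
    exact (hA.d_eq f x w).trans (hA'.d_eq f x w).symm
  · obtain ⟨u, hu⟩ := α.2
    obtain ⟨v, hv⟩ := β.2
    ext x w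
    exact (hA.bracket_eq α β u v hu hv x w).trans (hA'.bracket_eq α β u v hu hv x w).symm
  · rw [hA.act_eq, hA'.act_eq]
  · obtain ⟨u, hu⟩ := α.2
    obtain ⟨v, hv⟩ := β.2
    obtain ⟨w, hw⟩ := γ.2
    ext x
    exact (hA.jac_eq α β γ u v w hu hv hw x).trans (hA'.jac_eq α β γ u v w hu hv hw x).symm

end ThreeForm

end Hamiltonian

/-! ## Exact Courant algebroids with a splitting -/

section Courant

variable {E : Type*} [NormedAddCommGroup E] [NormedSpace ℝ E] [FiniteDimensional ℝ E]
  {M : Type*} [TopologicalSpace M] [T2Space M] [ChartedSpace E M] [IsManifold 𝓘(ℝ, E) ∞ M]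
  {F : Type*} [NormedAddCommGroup F] [NormedSpace ℝ F]
  {C : M → Type*} [TopologicalSpace (TotalSpace F C)] [∀ x, TopologicalSpace (C x)]
  [∀ x, AddCommGroup (C x)] [∀ x, Module ℝ (C x)]
  [∀ x, IsTopologicalAddGroup (C x)] [∀ x, ContinuousSMul ℝ (C x)]
  [FiberBundle F C] [VectorBundle ℝ F C] [ContMDiffVectorBundle ∞ F C 𝓘(ℝ, E)]

namespace CourantData

variable {K : CourantData E M F C} {s : BundleMap E M F C}

/-- The pairing of sections, as a bilinear map. -/
def pairL (K : CourantData E M F C) :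
    Sec E M F C →ₗ[ℝ] Sec E M F C →ₗ[ℝ] SmoothFn E M :=
  LinearMap.mk₂ ℝ K.pair
    (fun e₁ e₂ e => ContMDiffMap.ext fun x =>
      congrArg (fun φ => φ (e x)) (map_add (K.pairing x) (e₁ x) (e₂ x)))
    (fun c e₁ e => ContMDiffMap.ext fun x =>
      congrArg (fun φ => φ (e x)) (map_smul (K.pairing x) c (e₁ x)))
    (fun e e₁ e₂ => ContMDiffMap.ext fun x => map_add (K.pairing x (e x)) (e₁ x) (e₂ x))
    (fun c e e₁ => ContMDiffMap.ext fun x => map_smul (K.pairing x (e x)) c (e₁ x))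

theorem pair_eq (e₁ e₂ : Sec E M F C) : K.pair e₁ e₂ = K.pairL e₁ e₂ := rfl

/-- The anchor on sections, as a linear map. -/
def rhoL (K : CourantData E M F C) : Sec E M F C →ₗ[ℝ] VF E M where
  toFun := K.rho
  map_add' e₁ e₂ := ContMDiffSection.coe_injective (K.rho_add e₁ e₂)
  map_smul' c e := ContMDiffSection.coe_injective (K.rho_smul c e)

/-- The 1-form `⟨e, s(·)⟩`, as a linear map. -/
def toForm (K : CourantData E M F C) (s : BundleMap E M F C) :
    Sec E M F C →ₗ[ℝ] OneForm E M where
  toFun e := ⟨fun x => (K.pairing x (e x)).comp (s x),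
    ContMDiff.clm_bundle_comp ((K.pairing.contMDiff).clm_bundle_apply e.contMDiff) s.contMDiff⟩
  map_add' e₁ e₂ := ContMDiffSection.ext fun x =>
    congrArg (fun φ => φ.comp (s x)) (map_add (K.pairing x) (e₁ x) (e₂ x))
  map_smul' c e := ContMDiffSection.ext fun x =>
    congrArg (fun φ => φ.comp (s x)) (map_smul (K.pairing x) c (e x))

theorem contractOne_toForm (e : Sec E M F C) (w : VF E M) :
    contractOne (K.toForm s e) w = K.pairL e (lift s w) := rfl

theorem dorfman_eq (e₁ e₂ : Sec E M F C) :
    K.dorfman e₁ e₂ = K.bracket e₁ e₂ + (1 / 2 : ℝ) • K.D (K.pairL e₁ e₂) := rfl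

theorem T_eq (e₁ e₂ e₃ : Sec E M F C) :
    K.T e₁ e₂ e₃ = (1 / 6 : ℝ) • (K.pairL (K.bracket e₁ e₂) e₃ + K.pairL (K.bracket e₃ e₁) e₂
      + K.pairL (K.bracket e₂ e₃) e₁) := rfl

/-- The function `T`, as a trilinear map. -/
def TL (K : CourantData E M F C) :
    Sec E M F C →ₗ[ℝ] Sec E M F C →ₗ[ℝ] Sec E M F C →ₗ[ℝ] SmoothFn E M :=
  LinearMap.mk₂ ℝ
    (fun e₁ e₂ => (1 / 6 : ℝ) • (K.pairL (K.bracket e₁ e₂) + K.pairL.flip e₂ ∘ₗ K.bracket.flip e₁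
      + K.pairL.flip e₁ ∘ₗ K.bracket e₂))
    (fun e₁ e₁' e₂ => by
      rw [← smul_add]
      congr 1
      simp only [map_add, LinearMap.add_apply, LinearMap.comp_add, LinearMap.add_comp]
      abel)
    (fun c e₁ e₂ => by
      rw [smul_comm]
      congr 1
      simp only [map_smul, LinearMap.smul_apply, LinearMap.comp_smul, LinearMap.smul_comp,
        smul_add])
    (fun e₁ e₂ e₂' => by
      rw [← smul_add]
      congr 1
      simp only [map_add, LinearMap.comp_add, LinearMap.add_comp]
      abel)
    (fun c e₁ e₂ => by
      rw [smul_comm]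
      congr 1
      simp only [map_smul, LinearMap.comp_smul, LinearMap.smul_comp,
        smul_add])

theorem IsCourantAlgebroid.pairL_comm (hK : K.IsCourantAlgebroid) (e₁ e₂ : Sec E M F C) :
    K.pairL e₁ e₂ = K.pairL e₂ e₁ :=
  ContMDiffMap.ext fun x => hK.symm x _ _

theorem IsCourantAlgebroid.pairL_D (hK : K.IsCourantAlgebroid) (f : SmoothFn E M)
    (e : Sec E M F C) : K.pairL (K.D f) e = lieDeriv (K.rhoL e) f :=
  ContMDiffMap.ext fun x => hK.form_D f x (e x)

theorem IsCourantAlgebroid.rhoL_D (hK : K.IsCourantAlgebroid) (hex : K.IsExact)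
    (f : SmoothFn E M) : K.rhoL (K.D f) = 0 :=
  ContMDiffSection.ext fun x => (hex.exact x _).2 ⟨dForm f x, hK.form_D f x⟩

theorem IsCourantAlgebroid.rhoL_bracket (hK : K.IsCourantAlgebroid) (e₁ e₂ : Sec E M F C) :
    K.rhoL (K.bracket e₁ e₂) = lieBracketVF (K.rhoL e₁) (K.rhoL e₂) :=
  ContMDiffSection.ext fun x => hK.rho_bracket e₁ e₂ x

theorem IsCourantAlgebroid.rhoL_dorfman (hK : K.IsCourantAlgebroid) (hex : K.IsExact)
    (e₁ e₂ : Sec E M F C) :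
    K.rhoL (K.dorfman e₁ e₂) = lieBracketVF (K.rhoL e₁) (K.rhoL e₂) := by
  rw [dorfman_eq, map_add, map_smul, hK.rhoL_D hex, smul_zero, add_zero, hK.rhoL_bracket]

theorem IsCourantAlgebroid.lieDeriv_pairL (hK : K.IsCourantAlgebroid) (e₁ e₂ e₃ : Sec E M F C) :
    lieDeriv (K.rhoL e₁) (K.pairL e₂ e₃)
      = K.pairL (K.dorfman e₁ e₂) e₃ + K.pairL e₂ (K.dorfman e₁ e₃) :=
  ContMDiffMap.ext fun x => hK.invariance e₁ e₂ e₃ x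

theorem IsCourantAlgebroid.dorfman_add_dorfman_swap (hK : K.IsCourantAlgebroid)
    (e₁ e₂ : Sec E M F C) : K.dorfman e₁ e₂ + K.dorfman e₂ e₁ = K.D (K.pairL e₁ e₂) := by
  rw [dorfman_eq, dorfman_eq, hK.bracket_skew e₁ e₂, hK.pairL_comm e₂ e₁]
  module

theorem IsSplitting.rhoL_lift (hs : K.IsSplitting s) (v : VF E M) : K.rhoL (lift s v) = v :=
  ContMDiffSection.ext fun x => hs.anchor_comp x _

theorem IsSplitting.pairL_lift_lift (hs : K.IsSplitting s) (u v : VF E M) :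
    K.pairL (lift s u) (lift s v) = 0 :=
  ContMDiffMap.ext fun x => hs.isotropic x _ _

/-- By exactness `a` lies in the image of `ρ^*`, so pairing with it sees only the anchor of `b`. -/
theorem IsSplitting.form_of_anchor_eq_zero (hs : K.IsSplitting s) (hex : K.IsExact) {x : M}
    {a : C x} (ha : K.anchor x a = 0) (b : C x) :
    K.form x a b = K.form x a (s x (K.anchor x b)) := by
  obtain ⟨ξ, hξ⟩ := (hex.exact x a).1 ha
  rw [hξ, hξ, hs.anchor_comp]

/-- The uniqueness half of `C ≅ TM ⊕ T^*M`: a difference with zero anchor pairs with any vector as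
with an element of the image of `s`, hence trivially. -/
theorem sec_ext (hK : K.IsCourantAlgebroid) (hex : K.IsExact) (hs : K.IsSplitting s)
    {e e' : Sec E M F C} (h : K.rhoL e = K.rhoL e') (h' : K.toForm s e = K.toForm s e') :
    e = e' := by
  refine sub_eq_zero.1 (ContMDiffSection.ext fun x => hK.nondegenerate x _ fun b => ?_)
  have hr : K.rhoL (e - e') = 0 := by rw [map_sub, h, sub_self]
  have hf : K.toForm s (e - e') = 0 := by rw [map_sub, h', sub_self]
  rw [hs.form_of_anchor_eq_zero hex (congrArg (fun v : VF E M => v x) hr)]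
  exact congrArg (fun α : OneForm E M => α x (K.anchor x b)) hf

theorem pairL_eq (hK : K.IsCourantAlgebroid) (hex : K.IsExact) (hs : K.IsSplitting s)
    (e e' : Sec E M F C) :
    K.pairL e e' = contractOne (K.toForm s e) (K.rhoL e')
      + contractOne (K.toForm s e') (K.rhoL e) := by
  have h : K.pairL (e - lift s (K.rhoL e)) e'
      = K.pairL (e - lift s (K.rhoL e)) (lift s (K.rhoL e')) := by
    refine ContMDiffMap.ext fun x => hs.form_of_anchor_eq_zero hex ?_ _
    have hr : K.rhoL (e - lift s (K.rhoL e)) = 0 := by rw [map_sub, hs.rhoL_lift, sub_self]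
    exact congrArg (fun v : VF E M => v x) hr
  rw [map_sub, LinearMap.sub_apply, LinearMap.sub_apply, hs.pairL_lift_lift,
    hK.pairL_comm (lift s _) e'] at h
  rw [contractOne_toForm, contractOne_toForm]
  linear_combination h

theorem toForm_D (hK : K.IsCourantAlgebroid) (hs : K.IsSplitting s) (f : SmoothFn E M) :
    K.toForm s (K.D f) = dForm f :=
  oneForm_ext fun w => by
    rw [contractOne_toForm, hK.pairL_D, hs.rhoL_lift, contractOne_dForm]

/-! ### Sections preserving the splitting as Hamiltonian 1-forms. -/

variable {Ω : ThreeForm E M}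

theorem HasCurvatureNeg.contractOne_toForm_bracket (hcurv : K.HasCurvatureNeg s Ω)
    (u v w : VF E M) :
    contractOne (K.toForm s (K.bracket (lift s u) (lift s v))) w = -Ω.fn u v w :=
  ContMDiffMap.ext fun x => hcurv u v w x

/-- The symmetric part of the Dorfman bracket is exact, so `e ∘ s(b) = D⟨e, s(b)⟩ - s(b) ∘ e`;
invariance along `s(b)` then reduces `⟨s(b) ∘ e, s(c)⟩` to `⟨e, ⟦s(b), s(c)⟧⟩`, which the curvature
determines. -/
theorem contractOne_toForm_dorfman_lift (hK : K.IsCourantAlgebroid) (hex : K.IsExact)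
    (hs : K.IsSplitting s) (hcurv : K.HasCurvatureNeg s Ω) (e : Sec E M F C) (b c : VF E M) :
    contractOne (K.toForm s (K.dorfman e (lift s b))) c
      = -Ω.fn (K.rhoL e) b c - (lieDeriv b (contractOne (K.toForm s e) c)
        - lieDeriv c (contractOne (K.toForm s e) b)
        - contractOne (K.toForm s e) (lieBracketVF b c)) := by
  have h₁ := congrArg (fun e' => K.pairL e' (lift s c)) (hK.dorfman_add_dorfman_swap e (lift s b))
  have h₂ := hK.lieDeriv_pairL (lift s b) e (lift s c)
  have h₃ : K.dorfman (lift s b) (lift s c) = K.bracket (lift s b) (lift s c) := by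
    rw [dorfman_eq, hs.pairL_lift_lift, map_zero, smul_zero, add_zero]
  have h₄ := pairL_eq hK hex hs e (K.bracket (lift s b) (lift s c))
  simp only [map_add, LinearMap.add_apply, hK.pairL_D, hs.rhoL_lift] at h₁ h₂
  rw [hcurv.contractOne_toForm_bracket, hK.rhoL_bracket, hs.rhoL_lift, hs.rhoL_lift,
    ← Ω.fn_rotate] at h₄
  rw [h₃, h₄] at h₂
  simp only [contractOne_toForm] at h₁ h₂ ⊢
  linear_combination h₁ + h₂

/-- The sections `e ∘ s(b)` and `s([ρ(e), b])` always have the same anchor, and the form of the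
latter is zero. So they agree exactly when the form of the former, `-ω(ρ(e), b, ·) - dα(b, ·)`,
vanishes. -/
theorem preserves_iff (hK : K.IsCourantAlgebroid) (hex : K.IsExact) (hs : K.IsSplitting s)
    (hcurv : K.HasCurvatureNeg s Ω) {e : Sec E M F C} :
    K.Preserves s e ↔ Ω.IsHamiltonianVF (K.toForm s e) (K.rhoL e) := by
  have h₁ : K.Preserves s e ↔
      ∀ b, K.dorfman e (lift s b) = lift s (lieBracketVF (K.rhoL e) b) :=
    ⟨fun h b => ContMDiffSection.ext fun x => h b x,
      fun h b x => congrArg (fun e : Sec E M F C => e x) (h b)⟩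
  rw [h₁, ThreeForm.isHamiltonianVF_iff]
  refine forall_congr' fun b => ⟨fun h c => ?_, fun h => sec_ext hK hex hs ?_ ?_⟩
  · have key := contractOne_toForm_dorfman_lift hK hex hs hcurv e b c
    rw [h, contractOne_toForm, hs.pairL_lift_lift] at key
    linear_combination key
  · rw [hK.rhoL_dorfman hex, hs.rhoL_lift, hs.rhoL_lift]
  · refine oneForm_ext fun c => ?_
    rw [contractOne_toForm_dorfman_lift hK hex hs hcurv, h c, contractOne_toForm,
      hs.pairL_lift_lift, sub_self]

/-- The chain homotopy `½ (⟨e₂, s(ρ(e₁))⟩ - ⟨e₁, s(ρ(e₂))⟩)`. -/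
def homotopy (K : CourantData E M F C) (s : BundleMap E M F C) :
    Sec E M F C →ₗ[ℝ] Sec E M F C →ₗ[ℝ] SmoothFn E M :=
  (1 / 2 : ℝ) • ((contractOne.compl₁₂ (K.toForm s) K.rhoL).flip
    - contractOne.compl₁₂ (K.toForm s) K.rhoL)

theorem homotopy_apply (e₁ e₂ : Sec E M F C) :
    K.homotopy s e₁ e₂ = (1 / 2 : ℝ) • (contractOne (K.toForm s e₂) (K.rhoL e₁)
      - contractOne (K.toForm s e₁) (K.rhoL e₂)) := rfl

/-- Because `e₁` preserves `s`, invariance gives `e₁ ∘ e₂` the form `L_{v₁} α₂ = ω(v₁, v₂, ·) +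
d(α₂(v₁))`. Passing to the skew bracket subtracts `½ d(α₁(v₂) + α₂(v₁))`, which leaves the homotopy.
-/
theorem toForm_bracket (hK : K.IsCourantAlgebroid) (hex : K.IsExact) (hs : K.IsSplitting s)
    (hcurv : K.HasCurvatureNeg s Ω) {e₁ e₂ : Sec E M F C} (h₁ : K.Preserves s e₁)
    (h₂ : K.Preserves s e₂) :
    K.toForm s (K.bracket e₁ e₂)
      = Ω.contractTwo (K.rhoL e₁) (K.rhoL e₂) + dForm (K.homotopy s e₁ e₂) := by
  refine oneForm_ext fun w => ?_
  have h₃ := hK.lieDeriv_pairL e₁ e₂ (lift s w)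
  have h₄ : K.dorfman e₁ (lift s w) = lift s (lieBracketVF (K.rhoL e₁) w) :=
    ContMDiffSection.ext fun x => h₁ w x
  have h₅ := ThreeForm.isHamiltonianVF_iff.1 ((preserves_iff hK hex hs hcurv).1 h₂) (K.rhoL e₁) w
  rw [h₄, dorfman_eq, map_add, map_smul, LinearMap.add_apply, LinearMap.smul_apply, hK.pairL_D,
    hs.rhoL_lift, pairL_eq hK hex hs e₁ e₂] at h₃
  rw [Ω.fn_swap_left] at h₅
  rw [map_add, LinearMap.add_apply, contractOne_dForm, ← Ω.fn_eq, homotopy_apply, map_smul]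
  simp only [map_sub, map_add, contractOne_toForm] at h₃ h₅ ⊢
  linear_combination (norm := module) h₅ - h₃

theorem preserves_bracket (hΩ : Ω.IsTwoPlectic) (hK : K.IsCourantAlgebroid)
    (hex : K.IsExact) (hs : K.IsSplitting s) (hcurv : K.HasCurvatureNeg s Ω) {e₁ e₂ : Sec E M F C}
    (h₁ : K.Preserves s e₁) (h₂ : K.Preserves s e₂) : K.Preserves s (K.bracket e₁ e₂) := by
  rw [preserves_iff hK hex hs hcurv, toForm_bracket hK hex hs hcurv h₁ h₂, hK.rhoL_bracket,
    ← add_zero (lieBracketVF _ _)]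
  rw [preserves_iff hK hex hs hcurv] at h₁ h₂
  exact (h₁.contractTwo hΩ h₂).add (ThreeForm.isHamiltonianVF_dForm _)

theorem preserves_D (hK : K.IsCourantAlgebroid) (hex : K.IsExact) (hs : K.IsSplitting s)
    (hcurv : K.HasCurvatureNeg s Ω) (f : SmoothFn E M) : K.Preserves s (K.D f) := by
  rw [preserves_iff hK hex hs hcurv, toForm_D hK hs, hK.rhoL_D hex]
  exact ThreeForm.isHamiltonianVF_dForm f

/-- Nondegeneracy gives injectivity, and a fibre and its dual have the same finite dimension. -/
theorem isInvertible_pairing [FiniteDimensional ℝ F] (hK : K.IsCourantAlgebroid) (x : M) :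
    (K.pairing x : C x →L[ℝ] C x →L[ℝ] ℝ).IsInvertible := by
  have : T2Space (C x) := FiberBundle.t2Space F C x
  have : FiniteDimensional ℝ (C x) := VectorBundle.finiteDimensional ℝ F C x
  have hinj : Function.Injective (K.pairing x : C x →L[ℝ] C x →L[ℝ] ℝ).toLinearMap := by
    rw [injective_iff_map_eq_zero]
    exact fun a ha => hK.nondegenerate x a fun b => congrArg (fun φ : C x →L[ℝ] ℝ => φ b) ha
  let e : (C x →ₗ[ℝ] ℝ) ≃ₗ[ℝ] (C x →L[ℝ] ℝ) := LinearMap.toContinuousLinearMap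
  have : FiniteDimensional ℝ (C x →L[ℝ] ℝ) := e.finiteDimensional
  have hrank : Module.finrank ℝ (C x) = Module.finrank ℝ (C x →L[ℝ] ℝ) := by
    rw [← e.finrank_eq]
    exact Subspace.dual_finrank_eq.symm
  exact ⟨(LinearEquiv.ofInjectiveOfFinrankEq _ hinj hrank).toContinuousLinearEquiv, rfl⟩

/-- Every 1-form `α` and vector field `v` come from a section, namely from `s(v) + ρ^*(α)`. -/
theorem exists_toForm_eq_and_rhoL_eq [FiniteDimensional ℝ F] (hK : K.IsCourantAlgebroid)
    (hex : K.IsExact) (hs : K.IsSplitting s) (α : OneForm E M) (v : VF E M) :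
    ∃ e : Sec E M F C, K.toForm s e = α ∧ K.rhoL e = v := by
  have := FiniteDimensional.complete ℝ F
  -- This is `ρ^*(α)`: the inverse of the pairing applied to `α ∘ ρ`, smooth because fibrewise
  -- inversion is.
  let a : Sec E M F C :=
    ⟨fun x => (K.pairing x : C x →L[ℝ] C x →L[ℝ] Trivial M ℝ x).inverse
        ((α x).comp (K.anchor x)),
      (K.pairing.contMDiff.clm_bundle_inverse (isInvertible_pairing hK)).clm_bundle_apply
        (α.contMDiff.clm_bundle_comp K.anchor.contMDiff)⟩
  have ha x (b : C x) : K.form x (a x) b = α x (K.anchor x b) :=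
    congrArg (fun φ : C x →L[ℝ] ℝ => φ b) (ContinuousLinearMap.IsInvertible.self_apply_inverse
      (isInvertible_pairing hK x) ((α x).comp (K.anchor x)))
  have hρ : K.rhoL a = 0 := ContMDiffSection.ext fun x => (hex.exact x _).2 ⟨α x, ha x⟩
  have hα : K.toForm s a = α := ContMDiffSection.ext fun x => ContinuousLinearMap.ext fun w =>
    (ha x (s x w)).trans (congrArg (α x) (hs.anchor_comp x w))
  refine ⟨lift s v + a, ?_, by rw [map_add, hs.rhoL_lift, hρ, add_zero]⟩
  rw [map_add, hα, add_eq_right]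
  exact oneForm_ext fun w => by
    rw [contractOne_toForm, hs.pairL_lift_lift, map_zero, LinearMap.zero_apply]

/-- The Hamiltonian 1-form `⟨e, s(·)⟩` of a section `e` which preserves the splitting `s`. -/
def toHamiltonianForm (hK : K.IsCourantAlgebroid) (hex : K.IsExact) (hs : K.IsSplitting s)
    (hcurv : K.HasCurvatureNeg s Ω) : K.preserving s →ₗ[ℝ] Ω.hamiltonianForms :=
  (K.toForm s ∘ₗ (K.preserving s).subtype).codRestrict _
    fun e => ⟨_, (preserves_iff hK hex hs hcurv).1 e.2⟩

theorem coe_toHamiltonianForm (hK : K.IsCourantAlgebroid) (hex : K.IsExact)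
    (hs : K.IsSplitting s) (hcurv : K.HasCurvatureNeg s Ω) (e : K.preserving s) :
    (toHamiltonianForm hK hex hs hcurv e : OneForm E M) = K.toForm s e := rfl

theorem isHamiltonianVF_toHamiltonianForm (hK : K.IsCourantAlgebroid) (hex : K.IsExact)
    (hs : K.IsSplitting s) (hcurv : K.HasCurvatureNeg s Ω) (e : K.preserving s) :
    Ω.IsHamiltonianVF (toHamiltonianForm hK hex hs hcurv e : OneForm E M) (K.rhoL e) :=
  (preserves_iff hK hex hs hcurv).1 e.2

/-- Here the 2-plectic condition enters: the form alone determines the anchor, as its unique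
Hamiltonian vector field. -/
theorem toHamiltonianForm_bijective [FiniteDimensional ℝ F] (hΩ : Ω.IsTwoPlectic)
    (hK : K.IsCourantAlgebroid) (hex : K.IsExact) (hs : K.IsSplitting s)
    (hcurv : K.HasCurvatureNeg s Ω) :
    Function.Bijective (toHamiltonianForm hK hex hs hcurv) := by
  refine ⟨fun e e' h => Subtype.ext (sec_ext hK hex hs ?_ ?_), fun ⟨α, v, hv⟩ => ?_⟩
  · have h' := isHamiltonianVF_toHamiltonianForm hK hex hs hcurv e'
    rw [← h] at h'
    exact (isHamiltonianVF_toHamiltonianForm hK hex hs hcurv e).unique hΩ h'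
  · exact congrArg Subtype.val h
  · obtain ⟨e, rfl, rfl⟩ := exists_toForm_eq_and_rhoL_eq hK hex hs α v
    exact ⟨⟨e, (preserves_iff hK hex hs hcurv).2 hv⟩, rfl⟩

/-- The comparison of the Jacobiators of `L_∞(C)^s` and `L_∞(M, ω)`. -/
theorem neg_T_eq (hK : K.IsCourantAlgebroid) (hex : K.IsExact)
    (hs : K.IsSplitting s) (hcurv : K.HasCurvatureNeg s Ω) {e₁ e₂ e₃ : Sec E M F C}
    (h₁ : K.Preserves s e₁) (h₂ : K.Preserves s e₂) (h₃ : K.Preserves s e₃) :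
    -K.T e₁ e₂ e₃ = Ω.fn (K.rhoL e₃) (K.rhoL e₂) (K.rhoL e₁)
      + (K.homotopy s e₁ (K.bracket e₂ e₃) - K.homotopy s (K.bracket e₁ e₂) e₃
        - K.homotopy s e₂ (K.bracket e₁ e₃)) := by
  have d₁ := ThreeForm.isHamiltonianVF_iff.1 ((preserves_iff hK hex hs hcurv).1 h₁)
    (K.rhoL e₂) (K.rhoL e₃)
  have d₂ := ThreeForm.isHamiltonianVF_iff.1 ((preserves_iff hK hex hs hcurv).1 h₂)
    (K.rhoL e₃) (K.rhoL e₁)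
  have d₃ := ThreeForm.isHamiltonianVF_iff.1 ((preserves_iff hK hex hs hcurv).1 h₃)
    (K.rhoL e₁) (K.rhoL e₂)
  have r₁ := Ω.fn_rotate (K.rhoL e₁) (K.rhoL e₂) (K.rhoL e₃)
  have r₂ := Ω.fn_rotate (K.rhoL e₃) (K.rhoL e₁) (K.rhoL e₂)
  have r₃ := Ω.fn_swap_left (K.rhoL e₃) (K.rhoL e₂) (K.rhoL e₁)
  rw [hK.bracket_skew e₁ e₃, map_neg, T_eq, pairL_eq hK hex hs, pairL_eq hK hex hs _ e₂,
    pairL_eq hK hex hs _ e₁]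
  simp only [homotopy_apply, toForm_bracket hK hex hs hcurv, h₁, h₂, h₃, hK.rhoL_bracket, map_add,
    LinearMap.add_apply, LinearMap.sub_apply, LinearMap.smul_apply, contractOne_dForm, map_smul,
    map_sub, ← Ω.fn_eq]
  -- In the difference of the two sides `αᵢ([vⱼ, vₖ])`, with `i, j, k` cyclic, has coefficient `1/2
  -- - 1/6 = 1/3`, from the homotopy terms and from `T`. This fixes the multiple of each `dᵢ`; the
  -- `rᵢ` only reorder the arguments of `ω`.
  linear_combination (norm := module)
    -(1 / 3 : ℝ) • (d₁ + d₂ + d₃) - (2 / 3 : ℝ) • r₁ - (1 / 3 : ℝ) • r₂ - r₃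

theorem toHamiltonianForm_D (hΩ : Ω.IsTwoPlectic) (hK : K.IsCourantAlgebroid) (hex : K.IsExact)
    (hs : K.IsSplitting s) (hcurv : K.HasCurvatureNeg s Ω) (f : SmoothFn E M)
    {e : K.preserving s} (he : (e : Sec E M F C) = K.D f) :
    toHamiltonianForm hK hex hs hcurv e = (ThreeForm.hamiltonianLieTwoAlgebra hΩ).d f :=
  Subtype.ext <| by
    rw [coe_toHamiltonianForm, he, toForm_D hK hs]
    rfl

theorem toHamiltonianForm_bracket (hΩ : Ω.IsTwoPlectic) (hK : K.IsCourantAlgebroid)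
    (hex : K.IsExact) (hs : K.IsSplitting s) (hcurv : K.HasCurvatureNeg s Ω)
    {e e₁ e₂ : K.preserving s} (he : (e : Sec E M F C) = K.bracket e₁ e₂) :
    toHamiltonianForm hK hex hs hcurv e
      = (ThreeForm.hamiltonianLieTwoAlgebra hΩ).bracket (toHamiltonianForm hK hex hs hcurv e₁)
          (toHamiltonianForm hK hex hs hcurv e₂)
        + (ThreeForm.hamiltonianLieTwoAlgebra hΩ).d (K.homotopy s e₁ e₂) := by
  have h₁ := ThreeForm.hamiltonianVF_eq hΩ (isHamiltonianVF_toHamiltonianForm hK hex hs hcurv e₁)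
  have h₂ := ThreeForm.hamiltonianVF_eq hΩ (isHamiltonianVF_toHamiltonianForm hK hex hs hcurv e₂)
  refine Subtype.ext ?_
  rw [coe_toHamiltonianForm, he, toForm_bracket hK hex hs hcurv e₁.2 e₂.2, ← h₁, ← h₂]
  rfl

/-- Both sides are `½ ρ(e)(f)`: the Hamiltonian action is zero, and `D f` corresponds to the pair
`(0, df)`. -/
theorem half_pair_D_eq (hΩ : Ω.IsTwoPlectic) (hK : K.IsCourantAlgebroid) (hex : K.IsExact)
    (hs : K.IsSplitting s) (hcurv : K.HasCurvatureNeg s Ω) (e : K.preserving s)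
    (f : SmoothFn E M) :
    (1 / 2 : ℝ) • K.pair e (K.D f)
      = (ThreeForm.hamiltonianLieTwoAlgebra hΩ).act (toHamiltonianForm hK hex hs hcurv e) f
        + K.homotopy s e (K.D f) := by
  rw [homotopy_apply, toForm_D hK hs, hK.rhoL_D hex, contractOne_dForm, map_zero, sub_zero,
    pair_eq, hK.pairL_comm, hK.pairL_D]
  exact (zero_add _).symm

theorem neg_T_eq_jac (hΩ : Ω.IsTwoPlectic) (hK : K.IsCourantAlgebroid) (hex : K.IsExact)
    (hs : K.IsSplitting s) (hcurv : K.HasCurvatureNeg s Ω) (e₁ e₂ e₃ : K.preserving s) :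
    let A := ThreeForm.hamiltonianLieTwoAlgebra hΩ
    let p := toHamiltonianForm hK hex hs hcurv;
    -K.T e₁ e₂ e₃ = A.jac (p e₁) (p e₂) (p e₃)
      + (K.homotopy s e₁ (K.bracket e₂ e₃) - K.homotopy s (K.bracket e₁ e₂) e₃
        - K.homotopy s e₂ (K.bracket e₁ e₃) + A.act (p e₃) (K.homotopy s e₁ e₂)
        + A.act (p e₁) (K.homotopy s e₂ e₃) - A.act (p e₂) (K.homotopy s e₁ e₃)) := by
  intro A p
  have hA := ThreeForm.isHamiltonianLieTwoAlgebra hΩ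
  have hp := isHamiltonianVF_toHamiltonianForm hK hex hs hcurv
  have hj : A.jac (p e₁) (p e₂) (p e₃) = Ω.fn (K.rhoL e₃) (K.rhoL e₂) (K.rhoL e₁) :=
    ContMDiffMap.ext fun x => hA.jac_eq _ _ _ _ _ _ (hp e₁) (hp e₂) (hp e₃) x
  rw [neg_T_eq hK hex hs hcurv e₁.2 e₂.2 e₃.2, hj, hA.act_eq, hA.act_eq, hA.act_eq, add_zero,
    add_zero, sub_zero]

/-- The chain homotopy of the morphism from `L_∞(C)^s` to `L_∞(M, ω)`. -/
def preservingHomotopy (K : CourantData E M F C) (s : BundleMap E M F C) :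
    K.preserving s →ₗ[ℝ] K.preserving s →ₗ[ℝ] SmoothFn E M :=
  (K.homotopy s).compl₁₂ (K.preserving s).subtype (K.preserving s).subtype

theorem preservingHomotopy_apply (e₁ e₂ : K.preserving s) :
    K.preservingHomotopy s e₁ e₂ = K.homotopy s e₁ e₂ := rfl

theorem preservingHomotopy_skew (e₁ e₂ : K.preserving s) :
    K.preservingHomotopy s e₁ e₂ = -K.preservingHomotopy s e₂ e₁ := by
  rw [preservingHomotopy_apply, preservingHomotopy_apply, homotopy_apply, homotopy_apply,
    ← smul_neg, neg_sub]

/-- The Lie 2-algebra `L_∞(C)^s`. -/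
def preservingLieTwoAlgebra (hΩ : Ω.IsTwoPlectic) (hK : K.IsCourantAlgebroid) (hex : K.IsExact)
    (hs : K.IsSplitting s) (hcurv : K.HasCurvatureNeg s Ω) :
    LieTwoAlgebra (K.preserving s) (SmoothFn E M) :=
  (ThreeForm.hamiltonianLieTwoAlgebra hΩ).pullback
    (K.D.codRestrict (K.preserving s) (preserves_D hK hex hs hcurv))
    (LinearMap.mk₂ ℝ
      (fun e₁ e₂ => ⟨K.bracket e₁ e₂, preserves_bracket hΩ hK hex hs hcurv e₁.2 e₂.2⟩)
      (fun e₁ e₁' e₂ => Subtype.ext <| by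
        simp only [Submodule.coe_add, map_add, LinearMap.add_apply])
      (fun c e₁ e₂ => Subtype.ext <| by
        simp only [Submodule.coe_smul, map_smul, LinearMap.smul_apply])
      (fun e₁ e₂ e₂' => Subtype.ext <| by simp only [Submodule.coe_add, map_add])
      (fun c e₁ e₂ => Subtype.ext <| by simp only [Submodule.coe_smul, map_smul]))
    ((1 / 2 : ℝ) • K.pairL.compl₁₂ (K.preserving s).subtype K.D)
    (LinearMap.mk₂ ℝ (fun e₁ e₂ => -(K.TL e₁ e₂ ∘ₗ (K.preserving s).subtype))
      (fun e₁ e₁' e₂ => by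
        simp only [Submodule.coe_add, map_add, LinearMap.add_apply, LinearMap.add_comp, neg_add])
      (fun c e₁ e₂ => by
        simp only [Submodule.coe_smul, map_smul, LinearMap.smul_apply, LinearMap.smul_comp,
          smul_neg])
      (fun e₁ e₂ e₂' => by
        simp only [Submodule.coe_add, map_add, LinearMap.add_comp, neg_add])
      (fun c e₁ e₂ => by
        simp only [Submodule.coe_smul, map_smul, LinearMap.smul_comp, smul_neg]))
    (toHamiltonianForm hK hex hs hcurv) LinearMap.id (K.preservingHomotopy s)
    -- Equal forms have equal Hamiltonian vector fields, so the anchors agree as well.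
    (fun e e' h => Subtype.ext <| sec_ext hK hex hs
      ((isHamiltonianVF_toHamiltonianForm hK hex hs hcurv e).unique hΩ
        (h ▸ isHamiltonianVF_toHamiltonianForm hK hex hs hcurv e')) (congrArg Subtype.val h))
    Function.injective_id preservingHomotopy_skew
    (fun f => toHamiltonianForm_D hΩ hK hex hs hcurv f rfl)
    (fun e₁ e₂ => toHamiltonianForm_bracket hΩ hK hex hs hcurv rfl)
    (fun e f => half_pair_D_eq hΩ hK hex hs hcurv e f)
    (fun e₁ e₂ e₃ => neg_T_eq_jac hΩ hK hex hs hcurv e₁ e₂ e₃)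

theorem isPreservingLieTwoAlgebra (hΩ : Ω.IsTwoPlectic) (hK : K.IsCourantAlgebroid)
    (hex : K.IsExact) (hs : K.IsSplitting s) (hcurv : K.HasCurvatureNeg s Ω) :
    K.IsPreservingLieTwoAlgebra s (preservingLieTwoAlgebra hΩ hK hex hs hcurv) where
  d_eq _ := rfl
  bracket_eq _ _ := rfl
  act_eq _ _ := rfl
  jac_eq _ _ _ := rfl

theorem IsPreservingLieTwoAlgebra.unique {B B' : LieTwoAlgebra (K.preserving s) (SmoothFn E M)}
    (hB : K.IsPreservingLieTwoAlgebra s B) (hB' : K.IsPreservingLieTwoAlgebra s B') : B = B' :=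
  LieTwoAlgebra.eq_of_operations_eq
    (fun f => Subtype.ext <| (hB.d_eq f).trans (hB'.d_eq f).symm)
    (fun e₁ e₂ => Subtype.ext <| (hB.bracket_eq e₁ e₂).trans (hB'.bracket_eq e₁ e₂).symm)
    (fun e f => (hB.act_eq e f).trans (hB'.act_eq e f).symm)
    (fun e₁ e₂ e₃ => (hB.jac_eq e₁ e₂ e₃).trans (hB'.jac_eq e₁ e₂ e₃).symm)

theorem isomorphic_of_isPreservingLieTwoAlgebra [FiniteDimensional ℝ F] (hΩ : Ω.IsTwoPlectic)
    (hK : K.IsCourantAlgebroid) (hex : K.IsExact) (hs : K.IsSplitting s)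
    (hcurv : K.HasCurvatureNeg s Ω) {B : LieTwoAlgebra (K.preserving s) (SmoothFn E M)}
    (hB : K.IsPreservingLieTwoAlgebra s B) :
    B.Isomorphic (ThreeForm.hamiltonianLieTwoAlgebra hΩ) :=
  (LieTwoAlgebra.Hom.ofIntertwining (A := B) (toHamiltonianForm hK hex hs hcurv) LinearMap.id
    (K.preservingHomotopy s) preservingHomotopy_skew
    (fun f => toHamiltonianForm_D hΩ hK hex hs hcurv f (hB.d_eq f))
    (fun e₁ e₂ => toHamiltonianForm_bracket hΩ hK hex hs hcurv (hB.bracket_eq e₁ e₂))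
    (fun e f => by
      rw [preservingHomotopy_apply, hB.d_eq]
      exact (hB.act_eq e f).trans (half_pair_D_eq hΩ hK hex hs hcurv e f))
    (fun e₁ e₂ e₃ => by
      simp only [preservingHomotopy_apply, hB.bracket_eq]
      exact (hB.jac_eq e₁ e₂ e₃).trans (neg_T_eq_jac hΩ hK hex hs hcurv e₁ e₂ e₃))).isomorphic
    (toHamiltonianForm_bijective hΩ hK hex hs hcurv) Function.bijective_id

end CourantData

end Courant

end TwoPlectic

end

theorem mainTheorem3
    {E : Type*} [NormedAddCommGroup E] [NormedSpace ℝ E] [FiniteDimensional ℝ E]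
    {M : Type*} [TopologicalSpace M] [T2Space M] [ParacompactSpace M]
    [ChartedSpace E M] [IsManifold 𝓘(ℝ, E) ∞ M]
    {F : Type*} [NormedAddCommGroup F] [NormedSpace ℝ F] [FiniteDimensional ℝ F]
    {C : M → Type*} [TopologicalSpace (TotalSpace F C)] [∀ x, TopologicalSpace (C x)]
    [∀ x, AddCommGroup (C x)] [∀ x, Module ℝ (C x)]
    [∀ x, IsTopologicalAddGroup (C x)] [∀ x, ContinuousSMul ℝ (C x)]
    [FiberBundle F C] [VectorBundle ℝ F C] [ContMDiffVectorBundle ∞ F C 𝓘(ℝ, E)]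
    (Ω : TwoPlectic.ThreeForm E M) (hΩ : Ω.IsTwoPlectic)
    (K : TwoPlectic.CourantData E M F C) (hK : K.IsCourantAlgebroid) (hex : K.IsExact)
    (s : TwoPlectic.CourantData.BundleMap E M F C) (hs : K.IsSplitting s)
    (hcurv : K.HasCurvatureNeg s Ω) :
    (∃! A : TwoPlectic.LieTwoAlgebra Ω.hamiltonianForms (TwoPlectic.SmoothFn E M),
        Ω.IsHamiltonianLieTwoAlgebra A) ∧
      (∃! B : TwoPlectic.LieTwoAlgebra (K.preserving s) (TwoPlectic.SmoothFn E M),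
        K.IsPreservingLieTwoAlgebra s B) ∧
      ∀ (A : TwoPlectic.LieTwoAlgebra Ω.hamiltonianForms (TwoPlectic.SmoothFn E M))
        (B : TwoPlectic.LieTwoAlgebra (K.preserving s) (TwoPlectic.SmoothFn E M)),
        Ω.IsHamiltonianLieTwoAlgebra A → K.IsPreservingLieTwoAlgebra s B → A.Isomorphic B := by
  refine ⟨⟨_, TwoPlectic.ThreeForm.isHamiltonianLieTwoAlgebra hΩ, fun A hA =>
      hA.unique (TwoPlectic.ThreeForm.isHamiltonianLieTwoAlgebra hΩ)⟩,
    ⟨_, TwoPlectic.CourantData.isPreservingLieTwoAlgebra hΩ hK hex hs hcurv, fun B hB =>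
      hB.unique (TwoPlectic.CourantData.isPreservingLieTwoAlgebra hΩ hK hex hs hcurv)⟩,
    fun A B hA hB => ?_⟩
  rw [hA.unique (TwoPlectic.ThreeForm.isHamiltonianLieTwoAlgebra hΩ)]
  exact (TwoPlectic.CourantData.isomorphic_of_isPreservingLieTwoAlgebra
    hΩ hK hex hs hcurv hB).symm
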